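/- Let $d\ge 1$, let $0<\vartheta_1<\dots<\vartheta_d$, let $k(y\mid\theta)=e^{-\theta}\theta^y/y!$ be the Poisson kernel, and for a probability mass function $g$ on $\{\vartheta_1,\dots,\vartheta_d\}$ put $p_g(y)=\sum_{j=1}^d k(y\mid\vartheta_j)g(\vartheta_j)$ and $g(\vartheta_j\mid y)=k(y\mid\vartheta_j)g(\vartheta_j)/p_g(y)$, $y\in\mathbb N_0$. Let $\alpha_n\in(0,1)$, $n\ge1$, with $\sum_n\alpha_n=+\infty$ and $\sum_n\alpha_n^2<+\infty$, and let $g_0$ be a probability mass function on the grid. Let $(Y_n)_{n\ge1}$ be $\mathbb N_0$-valued random variables on a probability space $(\Omega,\mathcal F,\mathbb P)$, with natural filtration $\mathcal G_n=\sigma(Y_1,\dots,Y_n)$ ($\mathcal G_0$ trivial), such that for all $n\ge0$ and $y\in\mathbb N_0$ $$\mathbb P(Y_{n+1}=y\mid\mathcal G_n)=p_{g_n}(y)\quad\text{a.s.},\qquad g_{n+1}(\vartheta_j)=(1-\alpha_{n+1})\,g_n(\vartheta_j)+\alpha_{n+1}\,g_n(\vartheta_j\mid Y_{n+1}),\quad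 j=1,\dots,d.$$ Let $(b_n)_{n\ge1}$ be a nondecreasing sequence of strictly positive numbers with $$b_n\to+\infty,\qquad \sum_{n\ge1}\alpha_n^4b_n^2<+\infty,\qquad b_n\sup_{k\ge n}\alpha_k^2\to0,\qquad b_n\sum_{k\ge n}\alpha_k^2\to1 .$$ Then $g_n$ converges a.s. to a random probability mass function $\tilde g$ on the grid. Write $\mathbf g_n,\tilde{\mathbf g}\in\mathbb R^{d-1}$ for the vectors of the first $d-1$ values of $g_n,\tilde g$, and let $\mathbf V_{\tilde g}$ be the random $(d-1)\times(d-1)$ matrix with entries $$\mathbf V_{\tilde g,i,j}=\sum_{z\in\mathbb N_0}\tilde g(\vartheta_i\mid z)\,\tilde g(\vartheta_j\mid z)\,p_{\tilde g}(z)-\tilde g(\vartheta_i)\,\tilde g(\vartheta_j).$$ This matrix is positive semidefinite, and $b_n^{1/2}(\mathbf g_n-\tilde{\mathbf g})$ converges to the centered Gaussian kernel $\mathcal N(0,\mathbf V_{\tilde g})$ in the sense of almost-sure conditional convergence with respect to $(\mathcal G_n)$: for $\mathbb P$-almost every $\omega$, the regular conditional distribution of $b_n^{1/2}(\mathbf g_n-\tilde{\mathbf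 g})$ given $\mathcal G_n$, evaluated at $\omega$, converges weakly to $\mathcal N(0,\mathbf V_{\tilde g(\omega)})$ as $n\to\infty$. The same holds for the conditional distribution of $b_{n+1}^{1/2}(\mathbf g_{n+1}-\tilde{\mathbf g})$ given $\mathcal G_n$. If moreover $g_0(\vartheta_j)>0$ for every $j=1,\dots,d$, then $\mathbf V_{\tilde g}$ is almost surely positive definite. -/

import Mathlib

open MeasureTheory ProbabilityTheory Filter Topology

namespace QuasiBayes

noncomputable section

/-- The Poisson kernel `k(y ∣ θ)`. -/
def poisKernel (θ : ℝ) (y : ℕ) : ℝ :=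
  Real.exp (-θ) * θ ^ y / (Nat.factorial y : ℝ)

/-- The Poisson mixture `p_g(y) = ∑ j, k(y ∣ ϑ_j) g(ϑ_j)` over a grid of `m + 1` points. -/
def mixture {m : ℕ} (ϑ g : Fin (m + 1) → ℝ) (y : ℕ) : ℝ :=
  ∑ j, poisKernel (ϑ j) y * g j

/-- The posterior `g(ϑ_j ∣ y) = k(y ∣ ϑ_j) g(ϑ_j) / p_g(y)`. -/
def postMass {m : ℕ} (ϑ g : Fin (m + 1) → ℝ) (y : ℕ) (j : Fin (m + 1)) : ℝ :=
  poisKernel (ϑ j) y * g j / mixture ϑ g y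

/-- Newton's algorithm: `newton ϑ g₀ α Y n ω j` is `g_n(ϑ_j)`, computed from the observations
`Y 1, …, Y n` and the learning rates `α 1, …, α n`. -/
def newton {Ω : Type*} {m : ℕ} (ϑ g₀ : Fin (m + 1) → ℝ) (α : ℕ → ℝ) (Y : ℕ → Ω → ℕ) :
    ℕ → Ω → Fin (m + 1) → ℝ
  | 0 => fun _ => g₀
  | n + 1 => fun ω j =>
      (1 - α (n + 1)) * newton ϑ g₀ α Y n ω j
        + α (n + 1) * postMass ϑ (newton ϑ g₀ α Y n ω) (Y (n + 1) ω) j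

/-- `𝒢_n = σ(Y_1, …, Y_n)` (trivial for `n = 0`). -/
@[reducible] def natSigma {Ω : Type*} (Y : ℕ → Ω → ℕ) (n : ℕ) : MeasurableSpace Ω :=
  ⨆ k ∈ Finset.Icc 1 n, MeasurableSpace.comap (Y k) ⊤

/-- The learning model: `P(Y_{n+1} = y ∣ 𝒢_n) = p_{g_n}(y)` a.s., for all `n, y ≥ 0`, where `g_n`
is given by Newton's algorithm. The observations are `Y 1, Y 2, …`; `Y 0` plays no role. -/
structure IsLearningModel {Ω : Type*} [MeasurableSpace Ω] (P : Measure Ω) {m : ℕ}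
    (ϑ g₀ : Fin (m + 1) → ℝ) (α : ℕ → ℝ) (Y : ℕ → Ω → ℕ) : Prop where
  measurable : ∀ n, 1 ≤ n → Measurable (Y n)
  predictive : ∀ n y : ℕ,
    P[(Y (n + 1) ⁻¹' {y}).indicator (fun _ => (1 : ℝ)) | natSigma Y n]
      =ᵐ[P] fun ω => mixture ϑ (newton ϑ g₀ α Y n ω) y

/-- `g̃` is a random probability mass function on the grid that is the a.s. limit of `g_n`. -/
structure IsNewtonLimit {Ω : Type*} [MeasurableSpace Ω] (P : Measure Ω) {m : ℕ}
    (ϑ g₀ : Fin (m + 1) → ℝ) (α : ℕ → ℝ) (Y : ℕ → Ω → ℕ) (gt : Ω → Fin (m + 1) → ℝ) : Prop where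
  measurable : Measurable gt
  pmf : ∀ ω, gt ω ∈ stdSimplex ℝ (Fin (m + 1))
  tendsto : ∀ᵐ ω ∂P, Tendsto (fun n => newton ϑ g₀ α Y n ω) atTop (𝓝 (gt ω))

/-- The matrix `V_g`, with entries
`∑_z g(ϑ_i ∣ z) g(ϑ_j ∣ z) p_g(z) - g(ϑ_i) g(ϑ_j)` for `i, j = 1, …, d - 1`, where `d = m + 1`. -/
def covMatrix {m : ℕ} (ϑ g : Fin (m + 1) → ℝ) : Matrix (Fin m) (Fin m) ℝ :=
  Matrix.of fun i j =>
    (∑' z : ℕ, postMass ϑ g z i.castSucc * postMass ϑ g z j.castSucc * mixture ϑ g z)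
      - g i.castSucc * g j.castSucc

/-- The rescaled error `b_n^{1/2} (g_n - g̃)`, a pmf on the `d = m + 1` grid points being
represented by the vector of its first `d - 1` values. -/
def scaledError {Ω : Type*} {m : ℕ} (ϑ g₀ : Fin (m + 1) → ℝ) (α b : ℕ → ℝ) (Y : ℕ → Ω → ℕ)
    (gt : Ω → Fin (m + 1) → ℝ) (n : ℕ) (ω : Ω) : EuclideanSpace ℝ (Fin m) :=
  WithLp.toLp 2 fun i : Fin m =>
    Real.sqrt (b n) * (newton ϑ g₀ α Y n ω i.castSucc - gt ω i.castSucc)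

/-- A regular version of the conditional distribution of `X` given the sub-σ-algebra `𝒢`. -/
def condLaw {Ω E : Type*} {mΩ : MeasurableSpace Ω} [MeasurableSpace E] [StandardBorelSpace E]
    [Nonempty E] (P : Measure Ω) [IsFiniteMeasure P] (𝒢 : MeasurableSpace Ω) (X : Ω → E) (ω : Ω) :
    ProbabilityMeasure E :=
  ⟨@condDistrib Ω Ω E _ _ _ mΩ 𝒢 X (fun ω => ω) P _ ω,
    (@instIsMarkovKernelCondDistrib Ω Ω E _ _ _ mΩ P _ (fun ω => ω) X 𝒢).isProbabilityMeasure ω⟩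

/-- Almost sure conditional convergence of `(X_n)` to the kernel `K` with respect to `(𝒢_n)`:
for almost every `ω`, the conditional laws of `X_n` given `𝒢_n` converge weakly to `K ω`. -/
def AlmostSureCondConv {Ω E : Type*} {mΩ : MeasurableSpace Ω} [TopologicalSpace E] [PolishSpace E]
    [MeasurableSpace E] [BorelSpace E] [Nonempty E] (P : Measure Ω) [IsFiniteMeasure P]
    (𝒢 : ℕ → MeasurableSpace Ω) (X : ℕ → Ω → E) (K : Kernel Ω E) [IsMarkovKernel K] : Prop :=
  ∀ᵐ ω ∂P, Tendsto (fun n => condLaw P (𝒢 n) (X n) ω) atTop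
    (𝓝 (⟨K ω, inferInstance⟩ : ProbabilityMeasure E))

end

end QuasiBayes

namespace QuasiBayes

/-! Averaging the posterior over an observation drawn from the mixture gives back the prior, so each
coordinate of `newton` is a bounded martingale and converges almost surely. The increments are `α (n
+ 1)` times a centered variable bounded by one, whose conditional variance in direction `u` is
`postVar` at the current mass function. The remaining error after time `n` is therefore a sum of
small martingale increments with conditional variance close to `postVar` times `tailSq α n`, and `b
n * tailSq α n` tends to one.

The Gaussian limit is a Lindeberg replacement on conditional characteristic functions. `interpChar`
keeps the increments up to a later time and replaces all the following ones by a Gaussian factor,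
with the variance frozen at its value at time `n`. Moving that time by one step changes the integral
over a set of `natSigma Y n` by a controlled amount (`norm_setIntegral_interpChar_succ_sub_le`): the
linear term of the Taylor expansion vanishes, the quadratic term leaves the drift of the variance
since time `n`, and the rest is of third and fourth order. The drift is controlled in mean by the
square root of the tail, because the variance is Lipschitz (`abs_postVar_sub_le`) and martingale
increments are orthogonal. Summing gives the bound `gaussError`, proportional to the measure of the
set.

Since the bound holds on every set of the conditioning sigma-algebra, it becomes a pointwise bound
on the characteristic function of the conditional law. A countable dense set of frequencies,
continuity and Lévy's theorem give almost sure weak convergence (`almostSureCondConv_of_charFun`).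

For positive definiteness, a null direction of the covariance forces a posterior mean that does not
depend on the observation, which a Vandermonde argument excludes if all masses are positive
(`posDef_covMatrix`). The limit masses are positive because the expected reciprocals of the masses
stay bounded (`ae_pos_newtonLimit`). -/

lemma poisKernel_pos {θ : ℝ} (hθ : 0 < θ) (y : ℕ) : 0 < poisKernel θ y := by
  unfold poisKernel; positivity

lemma hasSum_poisKernel (θ : ℝ) : HasSum (poisKernel θ) 1 := by
  have h := (NormedSpace.expSeries_div_hasSum_exp (𝔸 := ℝ) θ).mul_left (Real.exp (-θ))
  rw [← Real.exp_eq_exp_ℝ, ← Real.exp_add, neg_add_cancel, Real.exp_zero] at h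
  refine h.congr_fun fun y => ?_
  simp [poisKernel, mul_div_assoc]

section Simplex

variable {ι : Type*} [Fintype ι] {g : ι → ℝ}

lemma le_one_of_mem_stdSimplex (hg : g ∈ stdSimplex ℝ ι) (j : ι) : g j ≤ 1 :=
  hg.2 ▸ Finset.single_le_sum (fun i _ => hg.1 i) (Finset.mem_univ j)

lemma abs_dotProduct_le_of_mem_stdSimplex {u : ι → ℝ} {B : ℝ} (hu : ∀ j, |u j| ≤ B)
    (hg : g ∈ stdSimplex ℝ ι) : |u ⬝ᵥ g| ≤ B := by
  calc |u ⬝ᵥ g| ≤ ∑ j, |u j * g j| := Finset.abs_sum_le_sum_abs _ _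
    _ ≤ ∑ j, B * g j := Finset.sum_le_sum fun j _ => by
        rw [abs_mul, abs_of_nonneg (hg.1 j)]
        exact mul_le_mul_of_nonneg_right (hu j) (hg.1 j)
    _ = B := by rw [← Finset.mul_sum, hg.2, mul_one]

end Simplex

/-! ### Mixtures, posteriors and the covariance matrix -/

section Grid

variable {m : ℕ} {ϑ g g' u : Fin (m + 1) → ℝ}

lemma mixture_pos (hϑ : ∀ j, 0 < ϑ j) (hg : g ∈ stdSimplex ℝ (Fin (m + 1))) (y : ℕ) :
    0 < mixture ϑ g y := by
  have hne : ∃ j, 0 < g j := by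
    by_contra! h
    have h0 : ∑ j, g j ≤ 0 := Finset.sum_nonpos fun j _ => h j
    linarith [hg.2]
  obtain ⟨j, hj⟩ := hne
  exact Finset.sum_pos' (fun i _ => mul_nonneg (poisKernel_pos (hϑ i) y).le (hg.1 i))
    ⟨j, Finset.mem_univ j, mul_pos (poisKernel_pos (hϑ j) y) hj⟩

lemma hasSum_mixture (hg : g ∈ stdSimplex ℝ (Fin (m + 1))) : HasSum (mixture ϑ g) 1 := by
  have h : HasSum (fun y => ∑ j, poisKernel (ϑ j) y * g j) (∑ j, 1 * g j) :=
    hasSum_sum fun j _ => (hasSum_poisKernel (ϑ j)).mul_right (g j)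
  simp only [one_mul, hg.2] at h
  exact h

lemma mixture_mul_postMass (hϑ : ∀ j, 0 < ϑ j) (hg : g ∈ stdSimplex ℝ (Fin (m + 1))) (y : ℕ)
    (j : Fin (m + 1)) : mixture ϑ g y * postMass ϑ g y j = poisKernel (ϑ j) y * g j :=
  mul_div_cancel₀ _ (mixture_pos hϑ hg y).ne'

lemma postMass_mem_stdSimplex (hϑ : ∀ j, 0 < ϑ j) (hg : g ∈ stdSimplex ℝ (Fin (m + 1))) (y : ℕ) :
    postMass ϑ g y ∈ stdSimplex ℝ (Fin (m + 1)) := by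
  refine ⟨fun j => div_nonneg (mul_nonneg (poisKernel_pos (hϑ j) y).le (hg.1 j))
    (mixture_pos hϑ hg y).le, ?_⟩
  simp only [postMass, ← Finset.sum_div]
  exact div_self (mixture_pos hϑ hg y).ne'

lemma summable_mixture_mul {E : Type*} [NormedAddCommGroup E] [NormedSpace ℝ E] [CompleteSpace E]
    (hϑ : ∀ j, 0 < ϑ j) (hg : g ∈ stdSimplex ℝ (Fin (m + 1))) {f : ℕ → E} {C : ℝ}
    (hf : ∀ y, ‖f y‖ ≤ C) : Summable fun y => mixture ϑ g y • f y := by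
  refine Summable.of_norm_bounded ((hasSum_mixture (ϑ := ϑ) hg).summable.mul_right C) fun y => ?_
  rw [norm_smul, Real.norm_of_nonneg (mixture_pos hϑ hg y).le]
  exact mul_le_mul_of_nonneg_left (hf y) (mixture_pos hϑ hg y).le

/-- The mixture cancels the denominator of the posterior, and the Poisson kernel sums to one. This
is the source of the martingale property. -/
lemma hasSum_mixture_mul_postMass (hϑ : ∀ j, 0 < ϑ j) (hg : g ∈ stdSimplex ℝ (Fin (m + 1)))
    (j : Fin (m + 1)) : HasSum (fun y => mixture ϑ g y * postMass ϑ g y j) (g j) := by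
  simp_rw [mixture_mul_postMass hϑ hg]
  simpa using (hasSum_poisKernel (ϑ j)).mul_right (g j)

lemma hasSum_mixture_mul_postMean (hϑ : ∀ j, 0 < ϑ j) (hg : g ∈ stdSimplex ℝ (Fin (m + 1)))
    (u : Fin (m + 1) → ℝ) :
    HasSum (fun y => mixture ϑ g y * (u ⬝ᵥ postMass ϑ g y)) (u ⬝ᵥ g) := by
  have h : HasSum (fun y => ∑ j, u j * (mixture ϑ g y * postMass ϑ g y j)) (∑ j, u j * g j) :=
    hasSum_sum fun j _ => (hasSum_mixture_mul_postMass hϑ hg j).mul_left (u j)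
  refine h.congr_fun fun y => ?_
  simp only [dotProduct, Finset.mul_sum]
  exact Finset.sum_congr rfl fun j _ => by ring

/-- The variance of the posterior mean of `u` when the observation has law `p_g`. -/
noncomputable def postVar (ϑ g u : Fin (m + 1) → ℝ) : ℝ :=
  (∑' y, mixture ϑ g y * (u ⬝ᵥ postMass ϑ g y) ^ 2) - (u ⬝ᵥ g) ^ 2

lemma exists_abs_le (u : Fin (m + 1) → ℝ) : ∃ B, ∀ j, |u j| ≤ B :=
  ⟨‖u‖, fun j => norm_le_pi_norm u j⟩

lemma summable_mixture_mul_postMean_sq (hϑ : ∀ j, 0 < ϑ j)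
    (hg : g ∈ stdSimplex ℝ (Fin (m + 1))) (u : Fin (m + 1) → ℝ) :
    Summable fun y => mixture ϑ g y * (u ⬝ᵥ postMass ϑ g y) ^ 2 := by
  obtain ⟨B, hB⟩ := exists_abs_le u
  refine summable_mixture_mul (E := ℝ) hϑ hg (C := B ^ 2) fun y => ?_
  rw [Real.norm_eq_abs, abs_pow]
  exact pow_le_pow_left₀ (abs_nonneg _)
    (abs_dotProduct_le_of_mem_stdSimplex hB (postMass_mem_stdSimplex hϑ hg y)) 2

lemma hasSum_postVar (hϑ : ∀ j, 0 < ϑ j) (hg : g ∈ stdSimplex ℝ (Fin (m + 1)))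
    (u : Fin (m + 1) → ℝ) :
    HasSum (fun y => mixture ϑ g y * (u ⬝ᵥ postMass ϑ g y - u ⬝ᵥ g) ^ 2) (postVar ϑ g u) := by
  have h := ((summable_mixture_mul_postMean_sq hϑ hg u).hasSum.sub
    ((hasSum_mixture_mul_postMean hϑ hg u).mul_right (2 * (u ⬝ᵥ g)))).add
    ((hasSum_mixture (ϑ := ϑ) hg).mul_right ((u ⬝ᵥ g) ^ 2))
  rw [show postVar ϑ g u = _ - (u ⬝ᵥ g) * (2 * (u ⬝ᵥ g)) + 1 * (u ⬝ᵥ g) ^ 2 by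
    simp only [postVar]; ring]
  exact h.congr_fun fun y => by ring

lemma postVar_nonneg (hϑ : ∀ j, 0 < ϑ j) (hg : g ∈ stdSimplex ℝ (Fin (m + 1)))
    (u : Fin (m + 1) → ℝ) : 0 ≤ postVar ϑ g u :=
  (hasSum_postVar hϑ hg u).nonneg fun y => mul_nonneg (mixture_pos hϑ hg y).le (sq_nonneg _)

lemma postVar_le (hϑ : ∀ j, 0 < ϑ j) (hg : g ∈ stdSimplex ℝ (Fin (m + 1))) {B : ℝ}
    (hu : ∀ j, |u j| ≤ B) : postVar ϑ g u ≤ B ^ 2 := by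
  have h1 : ∑' y, mixture ϑ g y * (u ⬝ᵥ postMass ϑ g y) ^ 2 ≤ 1 * B ^ 2 := by
    refine hasSum_le (fun y => ?_) (summable_mixture_mul_postMean_sq hϑ hg u).hasSum
      ((hasSum_mixture (ϑ := ϑ) hg).mul_right (B ^ 2))
    refine mul_le_mul_of_nonneg_left ?_ (mixture_pos hϑ hg y).le
    exact sq_le_sq.2 ((abs_dotProduct_le_of_mem_stdSimplex hu
      (postMass_mem_stdSimplex hϑ hg y)).trans (le_abs_self B))
  simp only [postVar]
  nlinarith [sq_nonneg (u ⬝ᵥ g)]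

lemma summable_postMass_mul (hϑ : ∀ j, 0 < ϑ j) (hg : g ∈ stdSimplex ℝ (Fin (m + 1)))
    (i j : Fin (m + 1)) :
    Summable fun z => postMass ϑ g z i * postMass ϑ g z j * mixture ϑ g z := by
  refine (summable_mixture_mul (E := ℝ) hϑ hg (C := 1)
    (f := fun z => postMass ϑ g z i * postMass ϑ g z j) fun y => ?_).congr fun z => by
      rw [smul_eq_mul, mul_comm]
  have hp := postMass_mem_stdSimplex hϑ hg y
  rw [Real.norm_of_nonneg (mul_nonneg (hp.1 i) (hp.1 j))]
  exact mul_le_one₀ (le_one_of_mem_stdSimplex hp i) (hp.1 j) (le_one_of_mem_stdSimplex hp j)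

lemma dotProduct_snoc_zero (x : Fin m → ℝ) (g : Fin (m + 1) → ℝ) :
    (Fin.snoc x 0 : Fin (m + 1) → ℝ) ⬝ᵥ g = ∑ i, x i * g i.castSucc := by
  simp [dotProduct, Fin.sum_univ_castSucc]

/-- Dropping the last mass amounts to testing against vectors with last entry zero, so the quadratic
form of the matrix is the variance of a posterior mean. Semidefiniteness, definiteness and the
Gaussian characteristic function are all read off from this. -/
lemma dotProduct_covMatrix_mulVec (hϑ : ∀ j, 0 < ϑ j) (hg : g ∈ stdSimplex ℝ (Fin (m + 1)))
    (x : Fin m → ℝ) :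
    x ⬝ᵥ (covMatrix ϑ g).mulVec x = postVar ϑ g (Fin.snoc x 0 : Fin (m + 1) → ℝ) := by
  have hs : ∀ i j : Fin m, Summable fun z => x i * x j *
      (postMass ϑ g z i.castSucc * postMass ϑ g z j.castSucc * mixture ϑ g z) :=
    fun i j => (summable_postMass_mul hϑ hg _ _).mul_left _
  have h1 : ∀ q : Fin (m + 1) → ℝ, ((Fin.snoc x 0 : Fin (m + 1) → ℝ) ⬝ᵥ q) ^ 2
      = ∑ i, ∑ j, x i * x j * (q i.castSucc * q j.castSucc) := by
    intro q
    rw [dotProduct_snoc_zero, sq, Finset.sum_mul_sum]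
    exact Finset.sum_congr rfl fun i _ => Finset.sum_congr rfl fun j _ => by ring
  have h2 : ∀ z, mixture ϑ g z * ((Fin.snoc x 0 : Fin (m + 1) → ℝ) ⬝ᵥ postMass ϑ g z) ^ 2
      = ∑ i, ∑ j, x i * x j *
        (postMass ϑ g z i.castSucc * postMass ϑ g z j.castSucc * mixture ϑ g z) := by
    intro z
    rw [h1, Finset.mul_sum]
    refine Finset.sum_congr rfl fun i _ => ?_
    rw [Finset.mul_sum]
    exact Finset.sum_congr rfl fun j _ => by ring
  rw [postVar, h1]
  simp_rw [h2]
  rw [Summable.tsum_finsetSum fun i _ => summable_sum fun j _ => hs i j]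
  simp_rw [fun i => Summable.tsum_finsetSum fun j (_ : j ∈ Finset.univ) => hs i j, tsum_mul_left,
    ← Finset.sum_sub_distrib, dotProduct, Matrix.mulVec, dotProduct, Finset.mul_sum]
  refine Finset.sum_congr rfl fun i _ => Finset.sum_congr rfl fun j _ => ?_
  simp only [covMatrix, Matrix.of_apply]
  ring

lemma posSemidef_covMatrix (hϑ : ∀ j, 0 < ϑ j) (hg : g ∈ stdSimplex ℝ (Fin (m + 1))) :
    (covMatrix ϑ g).PosSemidef := by
  refine Matrix.PosSemidef.of_dotProduct_mulVec_nonneg ?_ fun x => ?_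
  · ext i j
    simp only [covMatrix, Matrix.conjTranspose_apply, Matrix.of_apply, star_trivial]
    rw [mul_comm (g j.castSucc)]
    congr 2
    ext z
    ring
  · rw [star_trivial, dotProduct_covMatrix_mulVec hϑ hg]
    exact postVar_nonneg hϑ hg _

/-- If the variance vanishes, the posterior mean of `u` is the same for every observation, every
observation having positive probability. This gives a linear relation between the Poisson kernels,
which are independent for distinct parameters; hence `u` is constant, and its last entry is zero. -/
lemma posDef_covMatrix (hϑ : ∀ j, 0 < ϑ j) (hinj : Function.Injective ϑ)
    (hg : g ∈ stdSimplex ℝ (Fin (m + 1))) (hpos : ∀ j, 0 < g j) : (covMatrix ϑ g).PosDef := by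
  refine Matrix.PosDef.of_dotProduct_mulVec_pos (posSemidef_covMatrix hϑ hg).1 fun x hx => ?_
  rw [star_trivial, dotProduct_covMatrix_mulVec hϑ hg]
  refine (postVar_nonneg hϑ hg _).lt_of_ne' fun h0 => hx ?_
  set u : Fin (m + 1) → ℝ := Fin.snoc x 0 with hu
  have hs := hasSum_postVar hϑ hg u
  rw [h0, hasSum_zero_iff_of_nonneg
    fun y => mul_nonneg (mixture_pos hϑ hg y).le (sq_nonneg _)] at hs
  have hmean : ∀ y, u ⬝ᵥ postMass ϑ g y = u ⬝ᵥ g := fun y => by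
    have h := congrFun hs y
    simp only [Pi.zero_apply, mul_eq_zero, (mixture_pos hϑ hg y).ne', false_or] at h
    exact sub_eq_zero.1 (pow_eq_zero_iff two_ne_zero |>.1 h)
  -- Multiplied by `y!`, the relation says that all power sums in the nodes `ϑ j` vanish, so the
  -- Vandermonde matrix with distinct nodes kills the coefficients.
  have hlin : (fun j => (u j - u ⬝ᵥ g) * (Real.exp (-ϑ j) * g j)) = 0 := by
    refine Matrix.eq_zero_of_forall_pow_sum_mul_pow_eq_zero hinj fun y => ?_
    have h1 : ∑ j, u j * (poisKernel (ϑ j) y * g j) = u ⬝ᵥ g * mixture ϑ g y := by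
      rw [← hmean y, mul_comm, dotProduct, Finset.mul_sum]
      exact Finset.sum_congr rfl fun j _ => by rw [← mixture_mul_postMass hϑ hg]; ring
    have h2 : ∑ j, (u j - u ⬝ᵥ g) * (poisKernel (ϑ j) y * g j) = 0 := by
      simp_rw [sub_mul, Finset.sum_sub_distrib, h1, ← Finset.mul_sum]
      exact sub_self _
    have h3 := congrArg (fun r => (Nat.factorial (y : ℕ) : ℝ) * r) h2
    simp only [mul_zero, Finset.mul_sum] at h3
    rw [← h3]
    refine Finset.sum_congr rfl fun j _ => ?_
    have := Nat.factorial_ne_zero (y : ℕ)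
    simp only [poisKernel]
    field_simp
  have hconst : ∀ j, u j = u ⬝ᵥ g := fun j => by
    have h := congrFun hlin j
    simp only [Pi.zero_apply, mul_eq_zero, Real.exp_ne_zero, (hpos j).ne', or_false] at h
    linarith
  ext i
  have h1 := hconst i.castSucc
  have h2 := hconst (Fin.last m)
  simp only [hu, Fin.snoc_castSucc, Fin.snoc_last] at h1 h2
  simp [h1, ← h2]

/-- The posterior itself has no uniform Lipschitz bound, since the mixture may be small. But the
mixture and its product with the posterior mean are linear in `g`, and the summand of the second
moment can be compared through these two quantities and bounded factors only. -/
lemma abs_postVar_sub_le (hϑ : ∀ j, 0 < ϑ j) (hg : g ∈ stdSimplex ℝ (Fin (m + 1)))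
    (hg' : g' ∈ stdSimplex ℝ (Fin (m + 1))) {B : ℝ} (hu : ∀ j, |u j| ≤ B) :
    |postVar ϑ g u - postVar ϑ g' u| ≤ 5 * B ^ 2 * ∑ j, |g j - g' j| := by
  have hB : 0 ≤ B := (abs_nonneg _).trans (hu 0)
  set Δ := ∑ j, |g j - g' j| with hΔ
  have hN : ∀ {h : Fin (m + 1) → ℝ}, h ∈ stdSimplex ℝ (Fin (m + 1)) → ∀ y,
      mixture ϑ h y * (u ⬝ᵥ postMass ϑ h y) = ∑ j, u j * (poisKernel (ϑ j) y * h j) := by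
    intro h hh y
    rw [dotProduct, Finset.mul_sum]
    exact Finset.sum_congr rfl fun j _ => by rw [← mixture_mul_postMass hϑ hh]; ring
  have hterm : ∀ y, |mixture ϑ g y * (u ⬝ᵥ postMass ϑ g y) ^ 2
      - mixture ϑ g' y * (u ⬝ᵥ postMass ϑ g' y) ^ 2|
      ≤ 3 * B ^ 2 * ∑ j, poisKernel (ϑ j) y * |g j - g' j| := by
    intro y
    set S := ∑ j, poisKernel (ϑ j) y * |g j - g' j| with hS
    have hc := abs_dotProduct_le_of_mem_stdSimplex hu (postMass_mem_stdSimplex hϑ hg y)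
    have hc' := abs_dotProduct_le_of_mem_stdSimplex hu (postMass_mem_stdSimplex hϑ hg' y)
    have h1 : |mixture ϑ g y - mixture ϑ g' y| ≤ S := by
      rw [mixture, mixture, ← Finset.sum_sub_distrib]
      refine (Finset.abs_sum_le_sum_abs _ _).trans (Finset.sum_le_sum fun j _ => ?_)
      rw [← mul_sub, abs_mul, abs_of_pos (poisKernel_pos (hϑ j) y)]
    have h2 : |mixture ϑ g y * (u ⬝ᵥ postMass ϑ g y)
        - mixture ϑ g' y * (u ⬝ᵥ postMass ϑ g' y)| ≤ B * S := by
      rw [hN hg, hN hg', ← Finset.sum_sub_distrib, hS, Finset.mul_sum]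
      refine (Finset.abs_sum_le_sum_abs _ _).trans (Finset.sum_le_sum fun j _ => ?_)
      rw [← mul_sub, ← mul_sub, abs_mul, abs_mul, abs_of_pos (poisKernel_pos (hϑ j) y)]
      exact mul_le_mul_of_nonneg_right (hu j)
        (mul_nonneg (poisKernel_pos (hϑ j) y).le (abs_nonneg _))
    have hS0 : 0 ≤ S := (abs_nonneg _).trans h1
    generalize u ⬝ᵥ postMass ϑ g y = c at *
    generalize u ⬝ᵥ postMass ϑ g' y = c' at *
    generalize mixture ϑ g y = p at *
    generalize mixture ϑ g' y = p' at *
    -- Only `p - p'` and `p * c - p' * c'` occur as differences, both linear in `g - g'`; a direct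
    -- difference `c - c'` is avoided.
    have e : p * c ^ 2 - p' * c' ^ 2 = (c + c') * (p * c - p' * c') - c * c' * (p - p') := by ring
    rw [e]
    calc |(c + c') * (p * c - p' * c') - c * c' * (p - p')|
        ≤ |c + c'| * |p * c - p' * c'| + |c| * |c'| * |p - p'| := by
          rw [← abs_mul, ← abs_mul, ← abs_mul]; exact abs_sub _ _
      _ ≤ (B + B) * (B * S) + B * B * S := by
          gcongr
          exact (abs_add_le _ _).trans (add_le_add hc hc')
      _ = 3 * B ^ 2 * S := by ring
  have hsum : HasSum (fun y => 3 * B ^ 2 * ∑ j, poisKernel (ϑ j) y * |g j - g' j|)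
      (3 * B ^ 2 * ∑ j, 1 * |g j - g' j|) :=
    (hasSum_sum fun j _ => (hasSum_poisKernel (ϑ j)).mul_right _).mul_left _
  have hdiff := (summable_mixture_mul_postMean_sq hϑ hg u).hasSum.sub
    (summable_mixture_mul_postMean_sq hϑ hg' u).hasSum
  have h1 : |(∑' y, mixture ϑ g y * (u ⬝ᵥ postMass ϑ g y) ^ 2)
      - ∑' y, mixture ϑ g' y * (u ⬝ᵥ postMass ϑ g' y) ^ 2| ≤ 3 * B ^ 2 * Δ := by
    have h := hdiff.norm_le_of_bounded hsum hterm
    simpa [hΔ] using h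
  have h2 : |(u ⬝ᵥ g) ^ 2 - (u ⬝ᵥ g') ^ 2| ≤ 2 * B ^ 2 * Δ := by
    have h3 : |u ⬝ᵥ g - u ⬝ᵥ g'| ≤ B * Δ := by
      rw [← dotProduct_sub, dotProduct, hΔ, Finset.mul_sum]
      refine (Finset.abs_sum_le_sum_abs _ _).trans (Finset.sum_le_sum fun j _ => ?_)
      rw [abs_mul]
      exact mul_le_mul_of_nonneg_right (hu j) (abs_nonneg _)
    have h4 : |u ⬝ᵥ g + u ⬝ᵥ g'| ≤ B + B :=
      (abs_add_le _ _).trans (add_le_add (abs_dotProduct_le_of_mem_stdSimplex hu hg)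
        (abs_dotProduct_le_of_mem_stdSimplex hu hg'))
    rw [sq_sub_sq, abs_mul]
    calc _ ≤ (B + B) * (B * Δ) := by gcongr
      _ = _ := by ring
  calc |postVar ϑ g u - postVar ϑ g' u|
      = |((∑' y, mixture ϑ g y * (u ⬝ᵥ postMass ϑ g y) ^ 2)
        - ∑' y, mixture ϑ g' y * (u ⬝ᵥ postMass ϑ g' y) ^ 2)
        - ((u ⬝ᵥ g) ^ 2 - (u ⬝ᵥ g') ^ 2)| := by rw [postVar, postVar]; congr 1; ring
    _ ≤ 3 * B ^ 2 * Δ + 2 * B ^ 2 * Δ := (abs_sub _ _).trans (add_le_add h1 h2)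
    _ = 5 * B ^ 2 * Δ := by ring

end Grid

/-! ### Estimates for a single update -/

lemma exp_neg_sub_one_add_le {r : ℝ} (hr : 0 ≤ r) : |Real.exp (-r) - (1 - r)| ≤ r ^ 2 := by
  have h1 := Real.add_one_le_exp (-r)
  have h2 := Real.add_one_le_exp r
  have h3 : Real.exp (-r) ≤ 1 - r + r ^ 2 := by
    rw [Real.exp_neg, inv_le_iff_one_le_mul₀ (Real.exp_pos r)]
    nlinarith [pow_nonneg hr 3, mul_nonneg (sub_nonneg.2 h2)
      (by nlinarith [sq_nonneg (r - 1)] : (0 : ℝ) ≤ 1 - r + r ^ 2)]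
  rw [abs_of_nonneg (by linarith)]
  linarith

/-- For `|x| ≤ 1` this is the Taylor remainder; for larger `x` every term is dominated by a multiple
of `|x| ^ 3`, and this case dictates the constant. -/
lemma norm_exp_mul_I_taylor_le (x : ℝ) :
    ‖Complex.exp (x * Complex.I) - (1 + x * Complex.I - x ^ 2 / 2)‖ ≤ 4 * |x| ^ 3 := by
  have hx : ‖(x * Complex.I : ℂ)‖ = |x| := by simp
  rcases le_or_gt |x| 1 with h | h
  · have h1 := Complex.exp_bound (x := x * Complex.I) (by rwa [hx]) (n := 3) (by norm_num)
    rw [hx] at h1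
    have e : ∑ m ∈ Finset.range 3, (x * Complex.I : ℂ) ^ m / (m.factorial : ℂ)
        = 1 + x * Complex.I - x ^ 2 / 2 := by
      simp [Finset.sum_range_succ, mul_pow, Nat.factorial]
      ring
    rw [e] at h1
    refine h1.trans ?_
    rw [mul_comm]
    refine mul_le_mul_of_nonneg_right ?_ (by positivity)
    norm_num [Nat.factorial]
  · have h1 : ‖Complex.exp (x * Complex.I)‖ = 1 := Complex.norm_exp_ofReal_mul_I x
    have h2 : ‖(1 + x * Complex.I - x ^ 2 / 2 : ℂ)‖ ≤ 1 + |x| + |x| ^ 2 / 2 := by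
      refine (norm_sub_le _ _).trans (add_le_add ((norm_add_le _ _).trans ?_) ?_)
      · rw [hx, norm_one]
      · simp
    refine (norm_sub_le _ _).trans ?_
    rw [h1]
    nlinarith [pow_pos (zero_lt_one.trans h) 2, mul_pos (sub_pos.2 h) (zero_lt_one.trans h),
      mul_pos (sub_pos.2 h) (pow_pos (zero_lt_one.trans h) 2)]

section Grid

variable {m : ℕ} {ϑ g u : Fin (m + 1) → ℝ}

lemma abs_postMean_sub_le (hϑ : ∀ j, 0 < ϑ j) (hg : g ∈ stdSimplex ℝ (Fin (m + 1))) {B : ℝ}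
    (hu : ∀ j, |u j| ≤ B) (y : ℕ) : |u ⬝ᵥ postMass ϑ g y - u ⬝ᵥ g| ≤ 2 * B :=
  (abs_sub _ _).trans <| (add_le_add (abs_dotProduct_le_of_mem_stdSimplex hu
    (postMass_mem_stdSimplex hϑ hg y)) (abs_dotProduct_le_of_mem_stdSimplex hu hg)).trans_eq
      (two_mul B).symm

/-- The centered posterior mean has mean zero and variance `postVar`, so both exponentials agree
with `1 - w * a ^ 2 / 2` up to the gap between the variances and higher-order terms. The comparison
variance `w` is free, because it will be the variance frozen at an earlier time. -/
lemma norm_tsum_mixture_exp_sub_le (hϑ : ∀ j, 0 < ϑ j) (hg : g ∈ stdSimplex ℝ (Fin (m + 1)))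
    {B : ℝ} (hu : ∀ j, |u j| ≤ B) {w : ℝ} (hw0 : 0 ≤ w) (hw : w ≤ B ^ 2) (a : ℝ) :
    ‖(∑' y, mixture ϑ g y •
        Complex.exp ((a * (u ⬝ᵥ postMass ϑ g y - u ⬝ᵥ g) : ℝ) * Complex.I))
      - Real.exp (-(w * a ^ 2 / 2))‖
      ≤ a ^ 2 * |postVar ϑ g u - w| / 2 + 32 * (B * |a|) ^ 3 + (B * |a|) ^ 4 / 4 := by
  have hB : 0 ≤ B := (abs_nonneg _).trans (hu 0)
  set c : ℕ → ℝ := fun y => u ⬝ᵥ postMass ϑ g y - u ⬝ᵥ g with hc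
  have hcB : ∀ y, |c y| ≤ 2 * B := fun y => abs_postMean_sub_le hϑ hg hu y
  have hmean : HasSum (fun y => mixture ϑ g y * c y) 0 := by
    have h := (hasSum_mixture_mul_postMean hϑ hg u).sub
      ((hasSum_mixture (ϑ := ϑ) hg).mul_right (u ⬝ᵥ g))
    rw [one_mul, sub_self] at h
    exact h.congr_fun fun y => by simp only [hc]; ring
  have hvar : HasSum (fun y => mixture ϑ g y * c y ^ 2) (postVar ϑ g u) := hasSum_postVar hϑ hg u
  have hexp : HasSum (fun y => mixture ϑ g y • Complex.exp ((a * c y : ℝ) * Complex.I)) _ :=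
    (summable_mixture_mul (E := ℂ) hϑ hg (C := 1)
      fun y => (Complex.norm_exp_ofReal_mul_I _).le).hasSum
  have hmain : HasSum (fun y => mixture ϑ g y •
      (1 + (a * c y : ℝ) * Complex.I - ((a * c y : ℝ) : ℂ) ^ 2 / 2 : ℂ))
      (1 - (a ^ 2 * postVar ϑ g u / 2 : ℝ) : ℂ) := by
    have h0 := Complex.hasSum_ofReal.2 (hasSum_mixture (ϑ := ϑ) hg)
    have h1 := (Complex.hasSum_ofReal.2 (hmean.mul_left a)).mul_right Complex.I
    have h2 := Complex.hasSum_ofReal.2 ((hvar.mul_left (a ^ 2)).div_const 2)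
    have h := (h0.add h1).sub h2
    rw [mul_zero, Complex.ofReal_zero, zero_mul, add_zero, Complex.ofReal_one] at h
    refine h.congr_fun fun y => ?_
    rw [Complex.real_smul]
    push_cast
    ring
  have herr : ‖(∑' y, mixture ϑ g y • Complex.exp ((a * c y : ℝ) * Complex.I))
      - (1 - (a ^ 2 * postVar ϑ g u / 2 : ℝ) : ℂ)‖ ≤ 32 * (B * |a|) ^ 3 := by
    refine (hexp.sub hmain).norm_le_of_bounded
      (by simpa using (hasSum_mixture (ϑ := ϑ) hg).mul_right (32 * (B * |a|) ^ 3)) fun y => ?_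
    rw [← smul_sub, norm_smul, Real.norm_of_nonneg (mixture_pos hϑ hg y).le]
    refine mul_le_mul_of_nonneg_left ((norm_exp_mul_I_taylor_le _).trans ?_)
      (mixture_pos hϑ hg y).le
    -- The constant `32` is `4 * 2 ^ 3`: Taylor constant times the cube of the bound `2 * B` on the
    -- centered mean.
    calc 4 * |a * c y| ^ 3 ≤ 4 * (|a| * (2 * B)) ^ 3 := by
          rw [abs_mul]; gcongr; exact hcB y
      _ = 32 * (B * |a|) ^ 3 := by ring
  have hgauss : ‖((1 - (a ^ 2 * postVar ϑ g u / 2 : ℝ) : ℂ)) - Real.exp (-(w * a ^ 2 / 2))‖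
      ≤ a ^ 2 * |postVar ϑ g u - w| / 2 + (B * |a|) ^ 4 / 4 := by
    rw [← Complex.ofReal_one, ← Complex.ofReal_sub, ← Complex.ofReal_sub, Complex.norm_real,
      Real.norm_eq_abs]
    have h1 := exp_neg_sub_one_add_le (r := w * a ^ 2 / 2) (by positivity)
    have h2 : (w * a ^ 2 / 2) ^ 2 ≤ (B * |a|) ^ 4 / 4 := by
      have : w * a ^ 2 ≤ (B * |a|) ^ 2 := by
        rw [mul_pow, sq_abs]; gcongr
      calc (w * a ^ 2 / 2) ^ 2 = (w * a ^ 2) ^ 2 / 4 := by ring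
        _ ≤ ((B * |a|) ^ 2) ^ 2 / 4 := by gcongr
        _ = _ := by ring
    have e : 1 - a ^ 2 * postVar ϑ g u / 2 - Real.exp (-(w * a ^ 2 / 2))
        = -(a ^ 2 / 2 * (postVar ϑ g u - w)) - (Real.exp (-(w * a ^ 2 / 2))
          - (1 - w * a ^ 2 / 2)) := by ring
    rw [e]
    refine (abs_sub _ _).trans (add_le_add (le_of_eq ?_) (h1.trans h2))
    rw [abs_neg, abs_mul, abs_of_nonneg (by positivity : 0 ≤ a ^ 2 / 2)]
    ring
  refine (norm_sub_le_norm_sub_add_norm_sub _ (1 - (a ^ 2 * postVar ϑ g u / 2 : ℝ) : ℂ) _).trans ?_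
  linarith

/-- A single Newton update moves a squared coordinate deviation by at most `a ^ 2` on average. -/
lemma tsum_mixture_sq_add_le (hϑ : ∀ j, 0 < ϑ j) (hg : g ∈ stdSimplex ℝ (Fin (m + 1)))
    (j : Fin (m + 1)) (x a : ℝ) :
    ∑' y, mixture ϑ g y • (x + a * (postMass ϑ g y j - g j)) ^ 2 ≤ x ^ 2 + a ^ 2 := by
  have h0 := hasSum_mixture (ϑ := ϑ) hg
  have h1 := hasSum_mixture_mul_postMass hϑ hg j
  have hsq : ∀ y, |postMass ϑ g y j - g j| ≤ 1 := fun y => by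
    have hp := postMass_mem_stdSimplex hϑ hg y
    have := hp.1 j
    have := hg.1 j
    have := le_one_of_mem_stdSimplex hp j
    have := le_one_of_mem_stdSimplex hg j
    rw [abs_le]; constructor <;> linarith
  have h2 : HasSum (fun y => mixture ϑ g y * (2 * x * a * (postMass ϑ g y j - g j))) 0 := by
    have h := (h1.sub (h0.mul_right (g j))).mul_left (2 * x * a)
    rw [one_mul, sub_self, mul_zero] at h
    exact h.congr_fun fun y => by ring
  have hs : Summable fun y => mixture ϑ g y • (x + a * (postMass ϑ g y j - g j)) ^ 2 := by
    refine summable_mixture_mul (E := ℝ) hϑ hg (C := (|x| + |a| * 1) ^ 2) fun y => ?_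
    rw [Real.norm_eq_abs, abs_pow]
    refine pow_le_pow_left₀ (abs_nonneg _) ((abs_add_le _ _).trans ?_) 2
    rw [abs_mul]
    gcongr
    exact hsq y
  have hb := (h0.mul_right (x ^ 2 + a ^ 2)).add h2
  rw [one_mul, add_zero] at hb
  refine hasSum_le (fun y => ?_) hs.hasSum hb
  rw [smul_eq_mul, ← mul_add]
  refine mul_le_mul_of_nonneg_left ?_ (mixture_pos hϑ hg y).le
  have h3 : (postMass ϑ g y j - g j) ^ 2 ≤ 1 := by
    rw [sq_le_one_iff_abs_le_one]; exact hsq y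
  nlinarith [mul_le_mul_of_nonneg_left h3 (sq_nonneg a)]

/-- The quotient is an exponential tilt: again a Poisson kernel, with parameter `θ ^ 2 / θ'`, up to
a factor independent of `y`. It is therefore summable. -/
lemma poisKernel_sq_div {θ θ' : ℝ} (hθ' : 0 < θ') (y : ℕ) :
    poisKernel θ y ^ 2 / poisKernel θ' y
      = Real.exp (θ' - 2 * θ + θ ^ 2 / θ') * poisKernel (θ ^ 2 / θ') y := by
  have hf := Nat.factorial_ne_zero y
  simp only [poisKernel]
  rw [show θ' - 2 * θ + θ ^ 2 / θ' = θ ^ 2 / θ' + θ' + -θ + -θ by ring, Real.exp_add, Real.exp_add,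
    Real.exp_add, Real.exp_neg (θ ^ 2 / θ'), Real.exp_neg θ']
  have h1 := Real.exp_ne_zero (θ ^ 2 / θ')
  have h2 := Real.exp_ne_zero θ'
  rw [div_pow (θ ^ 2) θ' y, ← pow_mul θ, mul_comm 2 y, pow_mul θ]
  field_simp

/-- By pigeonhole some grid point carries mass at least `1 / (m + 1)`, so the mixture is bounded
below by a multiple of one Poisson kernel. Summing over all possible grid points makes the bound
independent of `g`. -/
lemma exists_tsum_poisKernel_sq_div_mixture_le (hϑ : ∀ j, 0 < ϑ j) (j : Fin (m + 1)) :
    ∃ C : ℝ, 0 ≤ C ∧ ∀ g ∈ stdSimplex ℝ (Fin (m + 1)),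
      Summable (fun y => poisKernel (ϑ j) y ^ 2 / mixture ϑ g y) ∧
      ∑' y, poisKernel (ϑ j) y ^ 2 / mixture ϑ g y ≤ C := by
  have hG : Summable fun y => ((m : ℝ) + 1) * ∑ i, poisKernel (ϑ j) y ^ 2 / poisKernel (ϑ i) y := by
    refine Summable.mul_left _ (summable_sum fun i _ => ?_)
    simp_rw [poisKernel_sq_div (hϑ i)]
    exact (hasSum_poisKernel _).summable.mul_left _
  have hG0 : ∀ y, 0 ≤ ((m : ℝ) + 1) * ∑ i, poisKernel (ϑ j) y ^ 2 / poisKernel (ϑ i) y := fun y =>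
    mul_nonneg (by positivity) (Finset.sum_nonneg fun i _ =>
      div_nonneg (sq_nonneg _) (poisKernel_pos (hϑ i) y).le)
  refine ⟨∑' y, ((m : ℝ) + 1) * ∑ i, poisKernel (ϑ j) y ^ 2 / poisKernel (ϑ i) y,
    tsum_nonneg hG0, fun g hg => ?_⟩
  obtain ⟨i, hi⟩ : ∃ i, 1 / ((m : ℝ) + 1) ≤ g i := by
    by_contra! h
    have h1 : ∑ i, g i < ∑ _i : Fin (m + 1), 1 / ((m : ℝ) + 1) :=
      Finset.sum_lt_sum_of_nonempty Finset.univ_nonempty fun i _ => h i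
    rw [hg.2] at h1
    simp at h1
    rw [mul_inv_cancel₀ (by positivity)] at h1
    exact lt_irrefl _ h1
  have hle : ∀ y, poisKernel (ϑ j) y ^ 2 / mixture ϑ g y
      ≤ ((m : ℝ) + 1) * ∑ i, poisKernel (ϑ j) y ^ 2 / poisKernel (ϑ i) y := by
    intro y
    have hk := poisKernel_pos (hϑ i) y
    have h1 : poisKernel (ϑ i) y / ((m : ℝ) + 1) ≤ mixture ϑ g y := by
      refine le_trans ?_ (Finset.single_le_sum (f := fun j => poisKernel (ϑ j) y * g j)
        (fun l _ => mul_nonneg (poisKernel_pos (hϑ l) y).le (hg.1 l)) (Finset.mem_univ i))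
      rw [div_eq_mul_one_div]
      exact mul_le_mul_of_nonneg_left hi hk.le
    calc poisKernel (ϑ j) y ^ 2 / mixture ϑ g y
        ≤ poisKernel (ϑ j) y ^ 2 / (poisKernel (ϑ i) y / ((m : ℝ) + 1)) := by gcongr
      _ = ((m : ℝ) + 1) * (poisKernel (ϑ j) y ^ 2 / poisKernel (ϑ i) y) := by
          field_simp
      _ ≤ _ := by
          gcongr
          exact Finset.single_le_sum (f := fun i => poisKernel (ϑ j) y ^ 2 / poisKernel (ϑ i) y)
            (fun l _ => div_nonneg (sq_nonneg _) (poisKernel_pos (hϑ l) y).le) (Finset.mem_univ i)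
  have hs : Summable fun y => poisKernel (ϑ j) y ^ 2 / mixture ϑ g y :=
    Summable.of_nonneg_of_le (fun y => div_nonneg (sq_nonneg _) (mixture_pos hϑ hg y).le) hle hG
  exact ⟨hs, hs.tsum_le_tsum hle hG⟩

lemma inv_one_add_le {x : ℝ} (hx : -(1 / 2) ≤ x) : (1 + x)⁻¹ ≤ 1 - x + 2 * x ^ 2 := by
  rw [inv_le_iff_one_le_mul₀ (by linarith)]
  nlinarith [mul_nonneg (sq_nonneg x) (by linarith : 0 ≤ 1 + 2 * x)]

/-- The update multiplies the mass by `1 + a * (R y - 1)`, where the likelihood ratio `R` has mean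
one under the mixture. Expanding the reciprocal, the linear term averages to zero and a multiple of
`a ^ 2` remains. The condition `a ≤ 1 / 2` keeps the factor away from zero. -/
lemma tsum_mixture_inv_le (hϑ : ∀ j, 0 < ϑ j) {j : Fin (m + 1)} {C : ℝ}
    (hC : ∀ g ∈ stdSimplex ℝ (Fin (m + 1)),
      Summable (fun y => poisKernel (ϑ j) y ^ 2 / mixture ϑ g y) ∧
      ∑' y, poisKernel (ϑ j) y ^ 2 / mixture ϑ g y ≤ C)
    (hg : g ∈ stdSimplex ℝ (Fin (m + 1))) (hj : 0 < g j) {a : ℝ} (ha0 : 0 ≤ a) (ha : a ≤ 1 / 2) :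
    ∑' y, mixture ϑ g y • ((1 - a) * g j + a * postMass ϑ g y j)⁻¹
      ≤ (1 + 2 * C * a ^ 2) * (g j)⁻¹ := by
  set R : ℕ → ℝ := fun y => poisKernel (ϑ j) y / mixture ϑ g y with hR
  have hR0 : ∀ y, 0 < R y := fun y => div_pos (poisKernel_pos (hϑ j) y) (mixture_pos hϑ hg y)
  have hpR : ∀ y, mixture ϑ g y * R y = poisKernel (ϑ j) y := fun y =>
    mul_div_cancel₀ _ (mixture_pos hϑ hg y).ne'
  have h0 := hasSum_mixture (ϑ := ϑ) hg
  have h1 : HasSum (fun y => mixture ϑ g y * R y) 1 := by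
    simp_rw [hpR]; exact hasSum_poisKernel _
  have h2 : HasSum (fun y => mixture ϑ g y * R y ^ 2)
      (∑' y, poisKernel (ϑ j) y ^ 2 / mixture ϑ g y) := by
    refine (hC g hg).1.hasSum.congr_fun fun y => ?_
    have := (mixture_pos hϑ hg y).ne'
    simp only [hR]
    field_simp
  set Q := ∑' y, poisKernel (ϑ j) y ^ 2 / mixture ϑ g y with hQ
  have hnew : ∀ y, (1 - a) * g j + a * postMass ϑ g y j = g j * (1 + a * (R y - 1)) := by
    intro y
    simp only [hR, postMass]
    ring
  have hb : HasSum (fun y => mixture ϑ g y * ((g j)⁻¹ *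
      (1 - a * (R y - 1) + 2 * (a * (R y - 1)) ^ 2))) ((g j)⁻¹ * (1 + 2 * a ^ 2 * (Q - 1))) := by
    have h := (((h0.mul_left (1 + a + 2 * a ^ 2)).sub (h1.mul_left (a + 4 * a ^ 2))).add
      (h2.mul_left (2 * a ^ 2))).mul_left (g j)⁻¹
    rw [show (g j)⁻¹ * (1 + 2 * a ^ 2 * (Q - 1)) = (g j)⁻¹ * ((1 + a + 2 * a ^ 2) * 1
      - (a + 4 * a ^ 2) * 1 + 2 * a ^ 2 * Q) by ring]
    exact h.congr_fun fun y => by ring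
  have hle : ∀ y, mixture ϑ g y • ((1 - a) * g j + a * postMass ϑ g y j)⁻¹
      ≤ mixture ϑ g y * ((g j)⁻¹ * (1 - a * (R y - 1) + 2 * (a * (R y - 1)) ^ 2)) := by
    intro y
    rw [hnew, smul_eq_mul, mul_inv]
    refine mul_le_mul_of_nonneg_left (mul_le_mul_of_nonneg_left (inv_one_add_le ?_)
      (inv_nonneg.2 hj.le)) (mixture_pos hϑ hg y).le
    nlinarith [mul_nonneg ha0 (hR0 y).le]
  have hs : Summable fun y => mixture ϑ g y • ((1 - a) * g j + a * postMass ϑ g y j)⁻¹ := by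
    refine Summable.of_nonneg_of_le (fun y => ?_) hle hb.summable
    rw [hnew]
    refine mul_nonneg (mixture_pos hϑ hg y).le (inv_nonneg.2 (mul_nonneg hj.le ?_))
    nlinarith [mul_nonneg ha0 (hR0 y).le]
  refine (hasSum_le hle hs.hasSum hb).trans ?_
  rw [mul_comm]
  refine mul_le_mul_of_nonneg_right ?_ (inv_nonneg.2 hj.le)
  have := (hC g hg).2
  nlinarith [mul_le_mul_of_nonneg_left this (sq_nonneg a), sq_nonneg a]

end Grid

/-! ### Measurability of the update and of the variance -/

section Measurability

lemma measurable_postMass {m : ℕ} (ϑ : Fin (m + 1) → ℝ) (y : ℕ) (j : Fin (m + 1)) :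
    Measurable fun g : Fin (m + 1) → ℝ => postMass ϑ g y j := by
  unfold postMass mixture
  fun_prop

lemma measurable_mixture {m : ℕ} (ϑ : Fin (m + 1) → ℝ) (y : ℕ) :
    Measurable fun g : Fin (m + 1) → ℝ => mixture ϑ g y := by
  unfold mixture
  fun_prop

lemma measurable_newton_step {Ω : Type*} {_ : MeasurableSpace Ω} {m : ℕ} (ϑ : Fin (m + 1) → ℝ)
    (a : ℝ) {g : Ω → Fin (m + 1) → ℝ} {X : Ω → ℕ} (hg : Measurable g) (hX : Measurable X) :
    Measurable fun ω j => (1 - a) * g ω j + a * postMass ϑ (g ω) (X ω) j := by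
  have h : ∀ j, Measurable fun p : (Fin (m + 1) → ℝ) × ℕ => postMass ϑ p.1 p.2 j := fun j =>
    measurable_from_prod_countable_left fun y => measurable_postMass ϑ y j
  exact measurable_pi_lambda _ fun j =>
    (((measurable_pi_apply j).comp hg).const_mul _).add
      (((h j).comp (hg.prodMk hX)).const_mul _)

lemma measurable_postVar_comp {Ω : Type*} {_ : MeasurableSpace Ω} {m : ℕ} {ϑ : Fin (m + 1) → ℝ}
    (hϑ : ∀ j, 0 < ϑ j) (u : Fin (m + 1) → ℝ) {g : Ω → Fin (m + 1) → ℝ} (hg : Measurable g)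
    (hgs : ∀ ω, g ω ∈ stdSimplex ℝ (Fin (m + 1))) : Measurable fun ω => postVar ϑ (g ω) u := by
  unfold postVar
  refine Measurable.sub ?_ (by unfold dotProduct; fun_prop)
  refine measurable_of_tendsto_metrizable (fun n => ?_)
    (tendsto_pi_nhds.2 fun ω =>
      (summable_mixture_mul_postMean_sq hϑ (hgs ω) u).hasSum.tendsto_sum_nat)
  refine Finset.measurable_sum _ fun y _ => ((measurable_mixture ϑ y).comp hg).mul
    (Measurable.pow_const ?_ 2)
  unfold dotProduct
  exact Finset.measurable_sum _ fun j _ => ((measurable_postMass ϑ y j).comp hg).const_mul _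

end Measurability

/-! ### Integrating out one observation, and the martingale limit -/

section Model

variable {Ω : Type*} {mΩ : MeasurableSpace Ω} {P : Measure Ω} {m : ℕ}
  {ϑ g₀ u : Fin (m + 1) → ℝ} {α : ℕ → ℝ} {Y : ℕ → Ω → ℕ}

lemma natSigma_mono (Y : ℕ → Ω → ℕ) : Monotone (natSigma Y) := fun _ _ h =>
  biSup_mono fun _ hk => Finset.Icc_subset_Icc_right h hk

lemma natSigma_le (hY : IsLearningModel P ϑ g₀ α Y) (n : ℕ) : natSigma Y n ≤ mΩ :=
  iSup₂_le fun k hk => (hY.measurable k (Finset.mem_Icc.1 hk).1).comap_le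

lemma newton_mem_stdSimplex (hϑ : ∀ j, 0 < ϑ j) (hg₀ : g₀ ∈ stdSimplex ℝ (Fin (m + 1)))
    (hα : ∀ n, 1 ≤ n → α n ∈ Set.Ioo (0 : ℝ) 1) (n : ℕ) (ω : Ω) :
    newton ϑ g₀ α Y n ω ∈ stdSimplex ℝ (Fin (m + 1)) := by
  induction n with
  | zero => exact hg₀
  | succ n ih =>
    have ha := hα (n + 1) (by omega)
    exact convex_stdSimplex ℝ _ ih (postMass_mem_stdSimplex hϑ ih (Y (n + 1) ω))
      (sub_nonneg.2 ha.2.le) ha.1.le (sub_add_cancel _ _)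

lemma measurable_newton (ϑ g₀ : Fin (m + 1) → ℝ) (α : ℕ → ℝ) (Y : ℕ → Ω → ℕ) (n : ℕ) :
    Measurable[natSigma Y n] (newton ϑ g₀ α Y n) := by
  induction n with
  | zero => exact measurable_const
  | succ n ih =>
    refine measurable_newton_step ϑ (α (n + 1)) (ih.mono (natSigma_mono Y n.le_succ) le_rfl) ?_
    refine Measurable.of_comap_le ?_
    exact le_biSup (fun k => MeasurableSpace.comap (Y k) ⊤) (Finset.mem_Icc.2 ⟨by omega, le_rfl⟩)

lemma measurable_newton_apply (ϑ g₀ : Fin (m + 1) → ℝ) (α : ℕ → ℝ) (Y : ℕ → Ω → ℕ) (n : ℕ)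
    (j : Fin (m + 1)) : Measurable[natSigma Y n] fun ω => newton ϑ g₀ α Y n ω j :=
  (measurable_pi_apply j).comp (measurable_newton ϑ g₀ α Y n)

variable [IsProbabilityMeasure P] {E : Type*} [NormedAddCommGroup E] [NormedSpace ℝ E]
  [CompleteSpace E]

/-- Split according to the value of the next observation, pull the factor known at time `n` out of
the conditional expectation of each indicator, and sum again; boundedness justifies both exchanges
of sum and integral. The predictive law enters the proof only here. -/
lemma integral_observation (hϑ : ∀ j, 0 < ϑ j) (hg₀ : g₀ ∈ stdSimplex ℝ (Fin (m + 1)))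
    (hα : ∀ n, 1 ≤ n → α n ∈ Set.Ioo (0 : ℝ) 1) (hY : IsLearningModel P ϑ g₀ α Y) (n : ℕ)
    {Φ : Ω → ℕ → E} {C : ℝ} (hΦ : ∀ y, StronglyMeasurable[natSigma Y n] fun ω => Φ ω y)
    (hC : ∀ ω y, ‖Φ ω y‖ ≤ C) :
    ∫ ω, Φ ω (Y (n + 1) ω) ∂P
      = ∫ ω, ∑' y, mixture ϑ (newton ϑ g₀ α Y n ω) y • Φ ω y ∂P := by
  have hle := natSigma_le hY n
  have hYm : ∀ y, MeasurableSet (Y (n + 1) ⁻¹' {y}) := fun y =>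
    hY.measurable (n + 1) (by omega) (measurableSet_singleton y)
  have hmix := fun ω => newton_mem_stdSimplex (Y := Y) hϑ hg₀ hα n ω
  have hmix1 : ∀ ω y, mixture ϑ (newton ϑ g₀ α Y n ω) y ≤ 1 := fun ω y =>
    le_hasSum (hasSum_mixture (hmix ω)) y fun z _ => (mixture_pos hϑ (hmix ω) z).le
  have hmixm : ∀ y, Measurable fun ω => mixture ϑ (newton ϑ g₀ α Y n ω) y := fun y =>
    (measurable_mixture ϑ y).comp ((measurable_newton ϑ g₀ α Y n).mono hle le_rfl)
  set I : ℕ → Ω → ℝ := fun y => (Y (n + 1) ⁻¹' {y}).indicator fun _ => (1 : ℝ) with hI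
  have hI0 : ∀ y ω, 0 ≤ I y ω := fun y ω => Set.indicator_nonneg (fun _ _ => zero_le_one) ω
  have hIint : ∀ y, Integrable (I y) P := fun y => (integrable_const 1).indicator (hYm y)
  have hΦm : ∀ y, AEStronglyMeasurable (fun ω => Φ ω y) P := fun y =>
    ((hΦ y).mono hle).aestronglyMeasurable
  have hint1 : ∀ y, Integrable (fun ω => I y ω • Φ ω y) P := fun y =>
    (hIint y).smul_bdd (C := C) (hΦm y) (ae_of_all _ fun ω => hC ω y)
  have hint2m : ∀ y, Integrable (fun ω => mixture ϑ (newton ϑ g₀ α Y n ω) y) P := fun y =>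
    Integrable.of_bound (hmixm y).aestronglyMeasurable 1 (ae_of_all _ fun ω => by
      rw [Real.norm_of_nonneg (mixture_pos hϑ (hmix ω) y).le]; exact hmix1 ω y)
  have hint2 : ∀ y, Integrable (fun ω => mixture ϑ (newton ϑ g₀ α Y n ω) y • Φ ω y) P := fun y =>
    (hint2m y).smul_bdd (C := C) (hΦm y) (ae_of_all _ fun ω => hC ω y)
  have hIeq : ∀ y, ∫ ω, I y ω ∂P = ∫ ω, mixture ϑ (newton ϑ g₀ α Y n ω) y ∂P := fun y => by
    rw [← integral_condExp hle]
    exact integral_congr_ae (hY.predictive n y)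
  have hterm : ∀ y, ∫ ω, I y ω • Φ ω y ∂P
      = ∫ ω, mixture ϑ (newton ϑ g₀ α Y n ω) y • Φ ω y ∂P := fun y => by
    rw [← integral_condExp hle]
    refine integral_congr_ae ((condExp_smul_of_aestronglyMeasurable_right
      (hIint y) (hint1 y) (hΦ y).aestronglyMeasurable).trans ?_)
    filter_upwards [hY.predictive n y] with ω hω
    simp only [Pi.smul_apply', hI]
    rw [hω]
  have hsumI : Summable fun y => ∫ ω, I y ω ∂P := by
    refine summable_of_sum_range_le (c := 1) (fun y => integral_nonneg (hI0 y)) fun N => ?_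
    rw [← integral_finsetSum _ fun y _ => hIint y]
    refine (integral_mono (integrable_finsetSum _ fun y _ => hIint y) (integrable_const 1)
      fun ω => ?_).trans (by simp)
    have hIte : ∀ y, I y ω = if Y (n + 1) ω = y then 1 else 0 := fun y => by
      simp [hI, Set.indicator]
    simp_rw [hIte]
    rw [Finset.sum_ite_eq]
    split_ifs <;> simp
  have hs1 : Summable fun y => ∫ ω, ‖I y ω • Φ ω y‖ ∂P := by
    refine Summable.of_nonneg_of_le (fun y => integral_nonneg fun ω => norm_nonneg _) (fun y => ?_)
      (hsumI.mul_right C)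
    rw [← integral_mul_const]
    refine integral_mono (hint1 y).norm ((hIint y).mul_const C) fun ω => ?_
    simp only [norm_smul, Real.norm_of_nonneg (hI0 y ω)]
    exact mul_le_mul_of_nonneg_left (hC ω y) (hI0 y ω)
  have hs2 : Summable fun y => ∫ ω, ‖mixture ϑ (newton ϑ g₀ α Y n ω) y • Φ ω y‖ ∂P := by
    refine Summable.of_nonneg_of_le (fun y => integral_nonneg fun ω => norm_nonneg _) (fun y => ?_)
      (hsumI.mul_right C)
    rw [hIeq, ← integral_mul_const]
    refine integral_mono (hint2 y).norm ((hint2m y).mul_const C) fun ω => ?_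
    simp only [norm_smul, Real.norm_of_nonneg (mixture_pos hϑ (hmix ω) y).le]
    exact mul_le_mul_of_nonneg_left (hC ω y) (mixture_pos hϑ (hmix ω) y).le
  have h1 := hasSum_integral_of_summable_integral_norm hint1 hs1
  have h2 := hasSum_integral_of_summable_integral_norm hint2 hs2
  simp_rw [hterm] at h1
  rw [← h1.unique h2]
  refine integral_congr_ae (ae_of_all _ fun ω => ?_)
  simp only
  rw [tsum_eq_single (Y (n + 1) ω) fun y hy => ?_]
  · simp [hI]
  · have : Y (n + 1) ω ≠ y := fun h => hy h.symm
    simp [hI, this]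

lemma setIntegral_observation (hϑ : ∀ j, 0 < ϑ j) (hg₀ : g₀ ∈ stdSimplex ℝ (Fin (m + 1)))
    (hα : ∀ n, 1 ≤ n → α n ∈ Set.Ioo (0 : ℝ) 1) (hY : IsLearningModel P ϑ g₀ α Y) (n : ℕ)
    {Φ : Ω → ℕ → E} {C : ℝ} (hΦ : ∀ y, StronglyMeasurable[natSigma Y n] fun ω => Φ ω y)
    (hC : ∀ ω y, ‖Φ ω y‖ ≤ C) {A : Set Ω} (hA : MeasurableSet[natSigma Y n] A) :
    ∫ ω in A, Φ ω (Y (n + 1) ω) ∂P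
      = ∫ ω in A, ∑' y, mixture ϑ (newton ϑ g₀ α Y n ω) y • Φ ω y ∂P := by
  have hA' := natSigma_le hY n A hA
  have h := integral_observation hϑ hg₀ hα hY n (Φ := fun ω y => A.indicator (fun ω => Φ ω y) ω)
    (C := C) (fun y => (hΦ y).indicator hA)
    fun ω y => (norm_indicator_le_norm_self _ _).trans (hC ω y)
  rw [← integral_indicator hA', ← integral_indicator hA']
  refine Eq.trans ?_ (h.trans ?_)
  · refine integral_congr_ae (ae_of_all _ fun ω => ?_)
    by_cases hω : ω ∈ A <;> simp [hω]
  · refine integral_congr_ae (ae_of_all _ fun ω => ?_)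
    by_cases hω : ω ∈ A <;> simp [hω]

/-- The filtration generated by the observations. -/
noncomputable def obsFiltration (hY : IsLearningModel P ϑ g₀ α Y) : Filtration ℕ mΩ where
  seq := natSigma Y
  mono' := natSigma_mono Y
  le' := natSigma_le hY

lemma norm_newton_apply_le_one (hϑ : ∀ j, 0 < ϑ j) (hg₀ : g₀ ∈ stdSimplex ℝ (Fin (m + 1)))
    (hα : ∀ n, 1 ≤ n → α n ∈ Set.Ioo (0 : ℝ) 1) (n : ℕ) (ω : Ω) (j : Fin (m + 1)) :
    ‖newton ϑ g₀ α Y n ω j‖ ≤ 1 := by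
  have h := newton_mem_stdSimplex (Y := Y) hϑ hg₀ hα n ω
  rw [Real.norm_of_nonneg (h.1 j)]
  exact le_one_of_mem_stdSimplex h j

lemma integrable_newton_apply (hϑ : ∀ j, 0 < ϑ j) (hg₀ : g₀ ∈ stdSimplex ℝ (Fin (m + 1)))
    (hα : ∀ n, 1 ≤ n → α n ∈ Set.Ioo (0 : ℝ) 1) (hY : IsLearningModel P ϑ g₀ α Y) (n : ℕ)
    (j : Fin (m + 1)) : Integrable (fun ω => newton ϑ g₀ α Y n ω j) P :=
  Integrable.of_bound
    ((measurable_newton_apply ϑ g₀ α Y n j).mono (natSigma_le hY n) le_rfl).aestronglyMeasurable 1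
    (ae_of_all _ fun ω => norm_newton_apply_le_one hϑ hg₀ hα n ω j)

lemma martingale_newton_apply (hϑ : ∀ j, 0 < ϑ j) (hg₀ : g₀ ∈ stdSimplex ℝ (Fin (m + 1)))
    (hα : ∀ n, 1 ≤ n → α n ∈ Set.Ioo (0 : ℝ) 1) (hY : IsLearningModel P ϑ g₀ α Y)
    (j : Fin (m + 1)) :
    Martingale (fun n ω => newton ϑ g₀ α Y n ω j) (obsFiltration hY) P := by
  have hint := fun n => integrable_newton_apply hϑ hg₀ hα hY n j
  refine martingale_nat (fun n => (measurable_newton_apply ϑ g₀ α Y n j).stronglyMeasurable)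
    hint fun n => ?_
  refine ae_eq_condExp_of_forall_setIntegral_eq (natSigma_le hY n) (hint (n + 1))
    (fun s _ _ => (hint n).integrableOn) (fun s hs _ => ?_)
    (measurable_newton_apply ϑ g₀ α Y n j).stronglyMeasurable.aestronglyMeasurable
  have ha := hα (n + 1) (by omega)
  have hsimp := fun ω => newton_mem_stdSimplex (Y := Y) hϑ hg₀ hα n ω
  have h := setIntegral_observation hϑ hg₀ hα hY n (C := 1) (A := s)
    (Φ := fun ω y => (1 - α (n + 1)) * newton ϑ g₀ α Y n ω j
      + α (n + 1) * postMass ϑ (newton ϑ g₀ α Y n ω) y j) (fun y => ?_) (fun ω y => ?_) hs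
  · refine Eq.trans ?_ h.symm
    refine setIntegral_congr_fun (natSigma_le hY n s hs) fun ω _ => ?_
    have h1 := ((hasSum_mixture (ϑ := ϑ) (hsimp ω)).mul_left
      ((1 - α (n + 1)) * newton ϑ g₀ α Y n ω j)).add
      ((hasSum_mixture_mul_postMass hϑ (hsimp ω) j).mul_left (α (n + 1)))
    refine ((h1.congr_fun fun y => ?_).tsum_eq.trans ?_).symm
    · rw [smul_eq_mul]
      ring
    · ring
  · refine Measurable.stronglyMeasurable ?_
    exact ((measurable_newton_apply ϑ g₀ α Y n j).const_mul _).add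
      (((measurable_postMass ϑ y j).comp (measurable_newton ϑ g₀ α Y n)).const_mul _)
  · have h := convex_stdSimplex ℝ _ (hsimp ω) (postMass_mem_stdSimplex hϑ (hsimp ω) y)
      (sub_nonneg.2 ha.2.le) ha.1.le (sub_add_cancel _ _)
    have h0 := h.1 j
    have h1 := le_one_of_mem_stdSimplex h j
    simp only [Pi.add_apply, Pi.smul_apply, smul_eq_mul] at h0 h1
    rwa [Real.norm_of_nonneg h0]

/-- Bounded martingales converge almost surely, and the simplex is closed. -/
lemma exists_isNewtonLimit (hϑ : ∀ j, 0 < ϑ j) (hg₀ : g₀ ∈ stdSimplex ℝ (Fin (m + 1)))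
    (hα : ∀ n, 1 ≤ n → α n ∈ Set.Ioo (0 : ℝ) 1) (hY : IsLearningModel P ϑ g₀ α Y) :
    ∃ gt : Ω → Fin (m + 1) → ℝ, IsNewtonLimit P ϑ g₀ α Y gt := by
  classical
  have hconv : ∀ᵐ ω ∂P, ∀ j, ∃ c, Tendsto (fun n => newton ϑ g₀ α Y n ω j) atTop (𝓝 c) := by
    rw [ae_all_iff]
    intro j
    refine (martingale_newton_apply hϑ hg₀ hα hY j).submartingale.exists_ae_tendsto_of_bdd
      (R := 1) fun n => ?_
    refine (eLpNorm_le_of_ae_bound (C := 1) (ae_of_all _ fun ω =>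
      norm_newton_apply_le_one hϑ hg₀ hα n ω j)).trans ?_
    simp
  have hmeas : ∀ n, Measurable (newton ϑ g₀ α Y n) := fun n =>
    (measurable_newton ϑ g₀ α Y n).mono (natSigma_le hY n) le_rfl
  obtain ⟨f, hf, hlim⟩ := measurable_limit_of_tendsto_metrizable_ae (μ := P) (L := atTop)
    (fun n => (hmeas n).aemeasurable) (by
      filter_upwards [hconv] with ω hω
      choose c hc using hω
      exact ⟨c, tendsto_pi_nhds.2 hc⟩)
  have hcl : IsClosed (stdSimplex ℝ (Fin (m + 1))) := isClosed_stdSimplex ℝ _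
  -- The measurable limit may leave the simplex on a null set; the value `g₀` there makes it a mass
  -- function everywhere.
  refine ⟨fun ω => if f ω ∈ stdSimplex ℝ (Fin (m + 1)) then f ω else g₀,
    Measurable.ite (hf hcl.measurableSet) hf measurable_const, fun ω => ?_, ?_⟩
  · split_ifs with h
    exacts [h, hg₀]
  · filter_upwards [hlim] with ω hω
    rwa [if_pos (hcl.mem_of_tendsto hω (Eventually.of_forall fun n =>
      newton_mem_stdSimplex hϑ hg₀ hα n ω))]

end Model

/-- The tail `∑_{k > n} α_k ^ 2`. -/
noncomputable def tailSq (α : ℕ → ℝ) (n : ℕ) : ℝ := ∑' k, α (n + 1 + k) ^ 2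

/-! ### Tails of the squared learning rates -/

section Tail

variable {α : ℕ → ℝ}

lemma summable_tailSq (hα_sq : Summable fun n : ℕ => α (n + 1) ^ 2) (n : ℕ) :
    Summable fun k => α (n + 1 + k) ^ 2 :=
  ((summable_nat_add_iff n).2 hα_sq).congr fun k => by congr 2; omega

lemma tailSq_eq_add (hα_sq : Summable fun n : ℕ => α (n + 1) ^ 2) (n : ℕ) :
    tailSq α n = α (n + 1) ^ 2 + tailSq α (n + 1) := by
  rw [tailSq, (summable_tailSq hα_sq n).tsum_eq_zero_add, tailSq]
  congr 1
  exact tsum_congr fun k => by congr 2; omega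

lemma tailSq_nonneg (α : ℕ → ℝ) (n : ℕ) : 0 ≤ tailSq α n := tsum_nonneg fun _ => sq_nonneg _

lemma tailSq_pos (hα : ∀ n, 1 ≤ n → α n ∈ Set.Ioo (0 : ℝ) 1)
    (hα_sq : Summable fun n : ℕ => α (n + 1) ^ 2) (n : ℕ) : 0 < tailSq α n := by
  rw [tailSq_eq_add hα_sq]
  exact add_pos_of_pos_of_nonneg (pow_pos (hα (n + 1) (by omega)).1 2) (tailSq_nonneg α _)

lemma sum_range_sq_le_tailSq (hα_sq : Summable fun n : ℕ => α (n + 1) ^ 2) (n k : ℕ) :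
    ∑ l ∈ Finset.range k, α (n + 1 + l) ^ 2 ≤ tailSq α n :=
  (summable_tailSq hα_sq n).sum_le_tsum _ fun _ _ => sq_nonneg _

lemma tendsto_tailSq (α : ℕ → ℝ) : Tendsto (tailSq α) atTop (𝓝 0) :=
  (tendsto_sum_nat_add fun n => α (n + 1) ^ 2).congr fun n => tsum_congr fun k => by congr 2; omega

end Tail

/-! ### Martingale increments and the Lindeberg replacement -/

section Model

variable {Ω : Type*} {mΩ : MeasurableSpace Ω} {P : Measure Ω} [IsProbabilityMeasure P] {m : ℕ}
  {ϑ g₀ u : Fin (m + 1) → ℝ} {α : ℕ → ℝ} {Y : ℕ → Ω → ℕ}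

lemma newton_succ_apply (n : ℕ) (ω : Ω) (j : Fin (m + 1)) :
    newton ϑ g₀ α Y (n + 1) ω j = newton ϑ g₀ α Y n ω j
      + α (n + 1) * (postMass ϑ (newton ϑ g₀ α Y n ω) (Y (n + 1) ω) j
        - newton ϑ g₀ α Y n ω j) := by
  rw [newton]
  ring

lemma dotProduct_newton_succ (u : Fin (m + 1) → ℝ) (n : ℕ) (ω : Ω) :
    u ⬝ᵥ newton ϑ g₀ α Y (n + 1) ω = u ⬝ᵥ newton ϑ g₀ α Y n ω
      + α (n + 1) * (u ⬝ᵥ postMass ϑ (newton ϑ g₀ α Y n ω) (Y (n + 1) ω)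
        - u ⬝ᵥ newton ϑ g₀ α Y n ω) := by
  simp only [dotProduct, newton_succ_apply, mul_add, Finset.sum_add_distrib,
    ← Finset.sum_sub_distrib, Finset.mul_sum]
  congr 1
  exact Finset.sum_congr rfl fun j _ => by ring

lemma abs_sub_le_one_of_mem_stdSimplex {g g' : Fin (m + 1) → ℝ}
    (hg : g ∈ stdSimplex ℝ (Fin (m + 1))) (hg' : g' ∈ stdSimplex ℝ (Fin (m + 1)))
    (j : Fin (m + 1)) : |g j - g' j| ≤ 1 := by
  have := hg.1 j
  have := hg'.1 j
  have := le_one_of_mem_stdSimplex hg j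
  have := le_one_of_mem_stdSimplex hg' j
  rw [abs_le]; constructor <;> linarith

lemma integrable_newton_sub_sq (hϑ : ∀ j, 0 < ϑ j) (hg₀ : g₀ ∈ stdSimplex ℝ (Fin (m + 1)))
    (hα : ∀ n, 1 ≤ n → α n ∈ Set.Ioo (0 : ℝ) 1) (hY : IsLearningModel P ϑ g₀ α Y) (k n : ℕ)
    (j : Fin (m + 1)) :
    Integrable (fun ω => (newton ϑ g₀ α Y k ω j - newton ϑ g₀ α Y n ω j) ^ 2) P := by
  have hm := fun k => (measurable_newton_apply ϑ g₀ α Y k j).mono (natSigma_le hY k) le_rfl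
  refine Integrable.of_bound (((hm k).sub (hm n)).pow_const 2).aestronglyMeasurable 1
    (ae_of_all _ fun ω => ?_)
  rw [Real.norm_of_nonneg (sq_nonneg _), sq_le_one_iff_abs_le_one]
  exact abs_sub_le_one_of_mem_stdSimplex (newton_mem_stdSimplex hϑ hg₀ hα k ω)
    (newton_mem_stdSimplex hϑ hg₀ hα n ω) j

/-- Orthogonality of martingale increments: conditionally on the past, the cross term vanishes and
each update adds at most the square of its rate. The set lies in all later sigma-algebras, so this
survives localization. -/
lemma setIntegral_newton_sub_sq_le (hϑ : ∀ j, 0 < ϑ j) (hg₀ : g₀ ∈ stdSimplex ℝ (Fin (m + 1)))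
    (hα : ∀ n, 1 ≤ n → α n ∈ Set.Ioo (0 : ℝ) 1) (hY : IsLearningModel P ϑ g₀ α Y) (n k : ℕ)
    (j : Fin (m + 1)) {A : Set Ω} (hA : MeasurableSet[natSigma Y n] A) :
    ∫ ω in A, (newton ϑ g₀ α Y (n + k) ω j - newton ϑ g₀ α Y n ω j) ^ 2 ∂P
      ≤ (∑ l ∈ Finset.range k, α (n + 1 + l) ^ 2) * P.real A := by
  induction k with
  | zero => simp
  | succ k ih =>
    have hmono := natSigma_mono Y (Nat.le_add_right n k)
    have hs := fun k ω => newton_mem_stdSimplex (Y := Y) hϑ hg₀ hα k ω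
    have ha := hα (n + k + 1) (by omega)
    have h := setIntegral_observation hϑ hg₀ hα hY (n + k) (C := 4) (A := A)
      (Φ := fun ω y => (newton ϑ g₀ α Y (n + k) ω j - newton ϑ g₀ α Y n ω j
        + α (n + k + 1) * (postMass ϑ (newton ϑ g₀ α Y (n + k) ω) y j
          - newton ϑ g₀ α Y (n + k) ω j)) ^ 2) (fun y => ?_) (fun ω y => ?_) (hmono A hA)
    · have e : ∀ ω, (newton ϑ g₀ α Y (n + (k + 1)) ω j - newton ϑ g₀ α Y n ω j) ^ 2
          = (newton ϑ g₀ α Y (n + k) ω j - newton ϑ g₀ α Y n ω j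
            + α (n + k + 1) * (postMass ϑ (newton ϑ g₀ α Y (n + k) ω) (Y (n + k + 1) ω) j
          - newton ϑ g₀ α Y (n + k) ω j)) ^ 2 := fun ω => by
        rw [← add_assoc, newton_succ_apply]
        ring
      simp_rw [e]
      rw [h]
      have hint := (integrable_newton_sub_sq hϑ hg₀ hα hY (n + k) n j).integrableOn (s := A)
      calc _ ≤ ∫ ω in A, ((newton ϑ g₀ α Y (n + k) ω j - newton ϑ g₀ α Y n ω j) ^ 2
              + α (n + k + 1) ^ 2) ∂P := by
            refine integral_mono_of_nonneg (ae_of_all _ fun ω => tsum_nonneg fun y =>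
              mul_nonneg (mixture_pos hϑ (hs _ ω) y).le (sq_nonneg _))
              (hint.add (integrable_const _)) (ae_of_all _ fun ω =>
                tsum_mixture_sq_add_le hϑ (hs _ ω) j _ _)
        _ ≤ _ := by
            rw [integral_add hint (integrable_const _), setIntegral_const, Finset.sum_range_succ,
              add_mul, smul_eq_mul, mul_comm (P.real A), show n + 1 + k = n + k + 1 by omega]
            gcongr
    · refine Measurable.stronglyMeasurable ?_
      have h1 := measurable_newton_apply ϑ g₀ α Y (n + k) j
      have h2 := (measurable_newton_apply ϑ g₀ α Y n j).mono hmono le_rfl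
      exact ((h1.sub h2).add ((((measurable_postMass ϑ y j).comp
        (measurable_newton ϑ g₀ α Y (n + k))).sub h1).const_mul _)).pow_const 2
    · have h1 := abs_sub_le_one_of_mem_stdSimplex (hs (n + k) ω) (hs n ω) j
      have h2 := abs_sub_le_one_of_mem_stdSimplex
        (postMass_mem_stdSimplex hϑ (hs (n + k) ω) y) (hs (n + k) ω) j
      rw [Real.norm_eq_abs, abs_pow, show (4 : ℝ) = (1 + 1 * 1) ^ 2 by norm_num]
      refine pow_le_pow_left₀ (abs_nonneg _) ((abs_add_le _ _).trans ?_) 2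
      rw [abs_mul, abs_of_pos ha.1]
      gcongr
      exact ha.2.le

/-- The elementary inequality `x ≤ r / 2 + x ^ 2 / (2 * r)`, with `r` the root of the tail, turns
the second-moment bound into one linear in the measure of `A`. That linearity is what later allows
passing to conditional expectations. -/
lemma setIntegral_abs_newton_sub_le (hϑ : ∀ j, 0 < ϑ j) (hg₀ : g₀ ∈ stdSimplex ℝ (Fin (m + 1)))
    (hα : ∀ n, 1 ≤ n → α n ∈ Set.Ioo (0 : ℝ) 1)
    (hα_sq : Summable fun n : ℕ => α (n + 1) ^ 2) (hY : IsLearningModel P ϑ g₀ α Y) (n k : ℕ)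
    (j : Fin (m + 1)) {A : Set Ω} (hA : MeasurableSet[natSigma Y n] A) :
    ∫ ω in A, |newton ϑ g₀ α Y (n + k) ω j - newton ϑ g₀ α Y n ω j| ∂P
      ≤ √(tailSq α n) * P.real A := by
  have hr : 0 < √(tailSq α n) := Real.sqrt_pos.2 (tailSq_pos hα hα_sq n)
  have hr2 : √(tailSq α n) ^ 2 = tailSq α n := Real.sq_sqrt (tailSq_nonneg α n)
  set r := √(tailSq α n) with hr_def
  have hint := (integrable_newton_sub_sq hϑ hg₀ hα hY (n + k) n j).integrableOn (s := A)
  have h2 : ∫ ω in A, (newton ϑ g₀ α Y (n + k) ω j - newton ϑ g₀ α Y n ω j) ^ 2 ∂P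
      ≤ r ^ 2 * P.real A := by
    refine (setIntegral_newton_sub_sq_le hϑ hg₀ hα hY n k j hA).trans ?_
    rw [hr2]
    exact mul_le_mul_of_nonneg_right (sum_range_sq_le_tailSq hα_sq n k) measureReal_nonneg
  calc _ ≤ ∫ ω in A, (r / 2 + (2 * r)⁻¹ *
          (newton ϑ g₀ α Y (n + k) ω j - newton ϑ g₀ α Y n ω j) ^ 2) ∂P := by
        refine integral_mono_of_nonneg (ae_of_all _ fun ω => abs_nonneg _)
          ((integrable_const _).add (hint.const_mul _)) (ae_of_all _ fun ω => ?_)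
        simp only
        rw [← sq_abs (newton ϑ g₀ α Y (n + k) ω j - newton ϑ g₀ α Y n ω j)]
        generalize |newton ϑ g₀ α Y (n + k) ω j - newton ϑ g₀ α Y n ω j| = x
        have : r / 2 + (2 * r)⁻¹ * x ^ 2 - x = (2 * r)⁻¹ * (x - r) ^ 2 := by field_simp; ring
        have : 0 ≤ (2 * r)⁻¹ * (x - r) ^ 2 := by positivity
        linarith
    _ = P.real A * (r / 2) + (2 * r)⁻¹ *
          ∫ ω in A, (newton ϑ g₀ α Y (n + k) ω j - newton ϑ g₀ α Y n ω j) ^ 2 ∂P := by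
        rw [integral_add (integrable_const _) (hint.const_mul _), setIntegral_const,
          integral_const_mul, smul_eq_mul]
    _ ≤ P.real A * (r / 2) + (2 * r)⁻¹ * (r ^ 2 * P.real A) := by gcongr
    _ = r * P.real A := by field_simp; ring

lemma setIntegral_abs_postVar_sub_le (hϑ : ∀ j, 0 < ϑ j) (hg₀ : g₀ ∈ stdSimplex ℝ (Fin (m + 1)))
    (hα : ∀ n, 1 ≤ n → α n ∈ Set.Ioo (0 : ℝ) 1)
    (hα_sq : Summable fun n : ℕ => α (n + 1) ^ 2) (hY : IsLearningModel P ϑ g₀ α Y) (n k : ℕ)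
    {B : ℝ} (hu : ∀ j, |u j| ≤ B) {A : Set Ω} (hA : MeasurableSet[natSigma Y n] A) :
    ∫ ω in A, |postVar ϑ (newton ϑ g₀ α Y (n + k) ω) u - postVar ϑ (newton ϑ g₀ α Y n ω) u| ∂P
      ≤ 5 * B ^ 2 * ((m + 1) * √(tailSq α n)) * P.real A := by
  have hs := fun k ω => newton_mem_stdSimplex (Y := Y) hϑ hg₀ hα k ω
  have hint : ∀ j ∈ Finset.univ, IntegrableOn
      (fun ω => |newton ϑ g₀ α Y (n + k) ω j - newton ϑ g₀ α Y n ω j|) A P := fun j _ =>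
    ((integrable_newton_apply hϑ hg₀ hα hY (n + k) j).sub
      (integrable_newton_apply hϑ hg₀ hα hY n j)).abs.integrableOn
  calc _ ≤ ∫ ω in A, 5 * B ^ 2 * ∑ j, |newton ϑ g₀ α Y (n + k) ω j - newton ϑ g₀ α Y n ω j| ∂P :=
        integral_mono_of_nonneg (ae_of_all _ fun ω => abs_nonneg _)
          ((integrable_finsetSum _ hint).const_mul _)
          (ae_of_all _ fun ω => abs_postVar_sub_le hϑ (hs _ ω) (hs _ ω) hu)
    _ = 5 * B ^ 2 * ∑ j, ∫ ω in A,
          |newton ϑ g₀ α Y (n + k) ω j - newton ϑ g₀ α Y n ω j| ∂P := by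
        rw [integral_const_mul, integral_finsetSum _ hint]
    _ ≤ 5 * B ^ 2 * ∑ _j : Fin (m + 1), √(tailSq α n) * P.real A := by
        gcongr with j _
        exact setIntegral_abs_newton_sub_le hϑ hg₀ hα hα_sq hY n k j hA
    _ = _ := by
        simp
        ring

/-- The characteristic function of the rescaled increment `g_n - g_k` in direction `u`, damped by
the Gaussian factor still to come. -/
noncomputable def interpChar (ϑ g₀ u : Fin (m + 1) → ℝ) (α : ℕ → ℝ) (Y : ℕ → Ω → ℕ) (b : ℝ)
    (n k : ℕ) (ω : Ω) : ℂ :=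
  Complex.exp ((√b * (u ⬝ᵥ newton ϑ g₀ α Y n ω - u ⬝ᵥ newton ϑ g₀ α Y k ω) : ℝ) * Complex.I)
    * Real.exp (-(postVar ϑ (newton ϑ g₀ α Y n ω) u * (b * tailSq α k) / 2))

lemma norm_exp_mul_I_mul_exp_neg_le (x : ℝ) {r : ℝ} (hr : 0 ≤ r) :
    ‖Complex.exp (x * Complex.I) * Real.exp (-r)‖ ≤ 1 := by
  rw [norm_mul, Complex.norm_exp_ofReal_mul_I, one_mul, Complex.norm_real,
    Real.norm_of_nonneg (Real.exp_pos _).le]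
  exact Real.exp_le_one_iff.2 (neg_nonpos.2 hr)

lemma measurable_dotProduct_newton (u : Fin (m + 1) → ℝ) (n : ℕ) :
    Measurable[natSigma Y n] fun ω => u ⬝ᵥ newton ϑ g₀ α Y n ω := by
  unfold dotProduct
  exact Finset.measurable_sum _ fun j _ => (measurable_newton_apply ϑ g₀ α Y n j).const_mul _

lemma measurable_postVar_newton (hϑ : ∀ j, 0 < ϑ j) (hg₀ : g₀ ∈ stdSimplex ℝ (Fin (m + 1)))
    (hα : ∀ n, 1 ≤ n → α n ∈ Set.Ioo (0 : ℝ) 1) (u : Fin (m + 1) → ℝ) (n : ℕ) :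
    Measurable[natSigma Y n] fun ω => postVar ϑ (newton ϑ g₀ α Y n ω) u :=
  measurable_postVar_comp hϑ u (measurable_newton ϑ g₀ α Y n)
    fun ω => newton_mem_stdSimplex hϑ hg₀ hα n ω

lemma measurable_exp_mul_exp {Ω : Type*} {_ : MeasurableSpace Ω} {f g : Ω → ℝ} (hf : Measurable f)
    (hg : Measurable g) :
    Measurable fun ω => Complex.exp ((f ω : ℝ) * Complex.I) * (Real.exp (g ω) : ℂ) := by
  fun_prop

lemma integrable_interpChar (hϑ : ∀ j, 0 < ϑ j) (hg₀ : g₀ ∈ stdSimplex ℝ (Fin (m + 1)))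
    (hα : ∀ n, 1 ≤ n → α n ∈ Set.Ioo (0 : ℝ) 1) (hY : IsLearningModel P ϑ g₀ α Y) {b : ℝ}
    (hb : 0 ≤ b) (n k : ℕ) : Integrable (interpChar ϑ g₀ u α Y b n k) P := by
  have hv := (measurable_postVar_newton (Y := Y) hϑ hg₀ hα u n).mono (natSigma_le hY n) le_rfl
  have hx := fun k => (measurable_dotProduct_newton (ϑ := ϑ) (g₀ := g₀) (α := α) (Y := Y) u k).mono
    (natSigma_le hY k) le_rfl
  refine Integrable.of_bound (measurable_exp_mul_exp (((hx n).sub (hx k)).const_mul _)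
    (((hv.mul_const _).div_const _).neg)).aestronglyMeasurable 1 (ae_of_all _ fun ω => ?_)
  refine norm_exp_mul_I_mul_exp_neg_le _ ?_
  have := postVar_nonneg hϑ (newton_mem_stdSimplex (Y := Y) hϑ hg₀ hα n ω) u
  have := tailSq_nonneg α k
  positivity

/-- One replacement step: the two integrands share a factor `S` of norm at most one, known at time
`n + k`, and differ in one increment against its Gaussian substitute. After integrating out the next
observation, the one-step estimate applies with variance frozen at time `n`. -/
lemma norm_setIntegral_interpChar_succ_sub_le (hϑ : ∀ j, 0 < ϑ j)
    (hg₀ : g₀ ∈ stdSimplex ℝ (Fin (m + 1))) (hα : ∀ n, 1 ≤ n → α n ∈ Set.Ioo (0 : ℝ) 1)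
    (hα_sq : Summable fun n : ℕ => α (n + 1) ^ 2) (hY : IsLearningModel P ϑ g₀ α Y)
    {b : ℝ} (hb : 0 ≤ b) (n k : ℕ) {B : ℝ} (hu : ∀ j, |u j| ≤ B) {A : Set Ω}
    (hA : MeasurableSet[natSigma Y n] A) :
    ‖∫ ω in A, interpChar ϑ g₀ u α Y b n (n + k + 1) ω ∂P
        - ∫ ω in A, interpChar ϑ g₀ u α Y b n (n + k) ω ∂P‖
      ≤ ((√b * α (n + k + 1)) ^ 2 * (5 * B ^ 2 * ((m + 1) * √(tailSq α n))) / 2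
        + 32 * (B * (√b * α (n + k + 1))) ^ 3 + (B * (√b * α (n + k + 1))) ^ 4 / 4)
        * P.real A := by
  have hmono := natSigma_mono Y (Nat.le_add_right n k)
  have hs := fun k ω => newton_mem_stdSimplex (Y := Y) hϑ hg₀ hα k ω
  have ha := hα (n + k + 1) (by omega)
  have ha0 : 0 ≤ √b * α (n + k + 1) := mul_nonneg (Real.sqrt_nonneg b) ha.1.le
  set a := √b * α (n + k + 1) with ha_def
  have hv0 := fun ω => postVar_nonneg hϑ (hs n ω) u
  have hvB := fun ω => postVar_le hϑ (hs n ω) hu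
  set S : Ω → ℂ := fun ω =>
    Complex.exp ((√b * (u ⬝ᵥ newton ϑ g₀ α Y n ω - u ⬝ᵥ newton ϑ g₀ α Y (n + k) ω) : ℝ)
      * Complex.I)
    * Real.exp (-(postVar ϑ (newton ϑ g₀ α Y n ω) u * (b * tailSq α (n + k + 1)) / 2)) with hS
  have hS1 : ∀ ω, ‖S ω‖ ≤ 1 := fun ω => by
    refine norm_exp_mul_I_mul_exp_neg_le _ ?_
    have := hv0 ω
    have := tailSq_nonneg α (n + k + 1)
    positivity
  -- The frequency is `-a` because `interpChar` uses the earlier mass function minus the later one.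
  set Φ : Ω → ℕ → ℂ := fun ω y => S ω *
    (Complex.exp ((-a * (u ⬝ᵥ postMass ϑ (newton ϑ g₀ α Y (n + k) ω) y
        - u ⬝ᵥ newton ϑ g₀ α Y (n + k) ω) : ℝ) * Complex.I)
      - Real.exp (-(postVar ϑ (newton ϑ g₀ α Y n ω) u * (-a) ^ 2 / 2))) with hΦ
  have hdiff : ∀ ω, interpChar ϑ g₀ u α Y b n (n + k + 1) ω
      - interpChar ϑ g₀ u α Y b n (n + k) ω = Φ ω (Y (n + k + 1) ω) := fun ω => by
    simp only [hΦ, hS, interpChar]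
    rw [mul_sub (_ : ℂ)]
    congr 1
    · rw [mul_right_comm (Complex.exp _), ← Complex.exp_add, ← add_mul,
        ← Complex.ofReal_add, dotProduct_newton_succ]
      congr 4
      simp only [ha_def]
      ring
    -- Peeling the first term off the tail produces the Gaussian factor of exactly this increment.
    · rw [mul_assoc, ← Complex.ofReal_mul, ← Real.exp_add, tailSq_eq_add hα_sq (n + k)]
      congr 3
      simp only [ha_def]
      rw [neg_sq, mul_pow, Real.sq_sqrt hb]
      ring
  have hv := (measurable_postVar_newton (Y := Y) hϑ hg₀ hα u n).mono hmono le_rfl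
  have hx := measurable_dotProduct_newton (ϑ := ϑ) (g₀ := g₀) (α := α) (Y := Y) u (n + k)
  have hx0 := (measurable_dotProduct_newton (ϑ := ϑ) (g₀ := g₀) (α := α) (Y := Y) u n).mono
    hmono le_rfl
  have hSm : Measurable[natSigma Y (n + k)] S :=
    measurable_exp_mul_exp ((hx0.sub hx).const_mul _) (((hv.mul_const _).div_const _).neg)
  have hΦm : ∀ y, StronglyMeasurable[natSigma Y (n + k)] fun ω => Φ ω y := fun y => by
    refine Measurable.stronglyMeasurable (hSm.mul (Measurable.sub ?_ ?_))
    · have hp : Measurable[natSigma Y (n + k)] fun ω =>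
          u ⬝ᵥ postMass ϑ (newton ϑ g₀ α Y (n + k) ω) y := by
        unfold dotProduct
        exact Finset.measurable_sum _ fun j _ =>
          ((measurable_postMass ϑ y j).comp (measurable_newton ϑ g₀ α Y (n + k))).const_mul _
      exact Complex.measurable_exp.comp
        ((Complex.measurable_ofReal.comp ((hp.sub hx).const_mul _)).mul_const _)
    · exact Complex.measurable_ofReal.comp
        (Real.measurable_exp.comp ((hv.mul_const _).div_const _).neg)
  have hexp1 : ∀ ω, ‖(Real.exp (-(postVar ϑ (newton ϑ g₀ α Y n ω) u * (-a) ^ 2 / 2)) : ℂ)‖ ≤ 1 :=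
    fun ω => by
      rw [Complex.norm_real, Real.norm_of_nonneg (Real.exp_pos _).le]
      have := hv0 ω
      exact Real.exp_le_one_iff.2 (neg_nonpos.2 (by positivity))
  have hΦC : ∀ ω y, ‖Φ ω y‖ ≤ 1 * (1 + 1) := fun ω y => by
    rw [norm_mul]
    refine mul_le_mul (hS1 ω) ((norm_sub_le _ _).trans (add_le_add ?_ (hexp1 ω)))
      (norm_nonneg _) zero_le_one
    exact (Complex.norm_exp_ofReal_mul_I _).le
  rw [← integral_sub (integrable_interpChar hϑ hg₀ hα hY hb n _).integrableOn
    (integrable_interpChar hϑ hg₀ hα hY hb n _).integrableOn]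
  simp_rw [hdiff]
  rw [setIntegral_observation hϑ hg₀ hα hY (n + k) hΦm hΦC (hmono A hA)]
  have hpt : ∀ ω, ‖∑' y, mixture ϑ (newton ϑ g₀ α Y (n + k) ω) y • Φ ω y‖
      ≤ a ^ 2 / 2 * |postVar ϑ (newton ϑ g₀ α Y (n + k) ω) u - postVar ϑ (newton ϑ g₀ α Y n ω) u|
        + (32 * (B * a) ^ 3 + (B * a) ^ 4 / 4) := fun ω => by
    have h := norm_tsum_mixture_exp_sub_le hϑ (hs (n + k) ω) hu (hv0 ω) (hvB ω) (-a)
    rw [abs_neg, abs_of_nonneg ha0, neg_sq] at h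
    have e : ∑' y, mixture ϑ (newton ϑ g₀ α Y (n + k) ω) y • Φ ω y = S ω *
        ((∑' y, mixture ϑ (newton ϑ g₀ α Y (n + k) ω) y •
          Complex.exp ((-a * (u ⬝ᵥ postMass ϑ (newton ϑ g₀ α Y (n + k) ω) y
            - u ⬝ᵥ newton ϑ g₀ α Y (n + k) ω) : ℝ) * Complex.I))
          - Real.exp (-(postVar ϑ (newton ϑ g₀ α Y n ω) u * a ^ 2 / 2))) := by
      have h1 := (summable_mixture_mul (E := ℂ) hϑ (hs (n + k) ω) (C := 1)
        (f := fun y => Complex.exp ((-a * (u ⬝ᵥ postMass ϑ (newton ϑ g₀ α Y (n + k) ω) y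
            - u ⬝ᵥ newton ϑ g₀ α Y (n + k) ω) : ℝ) * Complex.I))
        fun y => (Complex.norm_exp_ofReal_mul_I _).le).hasSum
      have h2 := (hasSum_mixture (ϑ := ϑ) (hs (n + k) ω)).smul_const
        (Real.exp (-(postVar ϑ (newton ϑ g₀ α Y n ω) u * a ^ 2 / 2)) : ℂ)
      rw [one_smul] at h2
      refine (((h1.sub h2).mul_left (S ω)).congr_fun fun y => ?_).tsum_eq
      simp only [hΦ, neg_sq]
      rw [← smul_sub, mul_smul_comm]
    rw [e, norm_mul]
    calc _ ≤ 1 * _ := mul_le_mul (hS1 ω) h (norm_nonneg _) zero_le_one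
      _ = _ := by ring
  have hint : IntegrableOn (fun ω => |postVar ϑ (newton ϑ g₀ α Y (n + k) ω) u
      - postVar ϑ (newton ϑ g₀ α Y n ω) u|) A P := by
    have hvm := fun k => (measurable_postVar_newton (Y := Y) hϑ hg₀ hα u k).mono
      (natSigma_le hY k) le_rfl
    have hvi : ∀ k, Integrable (fun ω => postVar ϑ (newton ϑ g₀ α Y k ω) u) P := fun k =>
      Integrable.of_bound (hvm k).aestronglyMeasurable (B ^ 2) (ae_of_all _ fun ω => by
        rw [Real.norm_of_nonneg (postVar_nonneg hϑ (hs k ω) u)]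
        exact postVar_le hϑ (hs k ω) hu)
    exact ((hvi _).sub (hvi _)).abs.integrableOn
  refine (norm_integral_le_of_norm_le ((hint.const_mul _).add (integrable_const _))
    (ae_of_all _ hpt)).trans ?_
  rw [integral_add' (hint.const_mul _) (integrable_const _), integral_const_mul, setIntegral_const,
    smul_eq_mul]
  have h := mul_le_mul_of_nonneg_left
    (setIntegral_abs_postVar_sub_le hϑ hg₀ hα hα_sq hY n k hu hA) (by positivity : 0 ≤ a ^ 2 / 2)
  linarith

end Model

/-- The error in the Gaussian approximation of the conditional characteristic function. -/
noncomputable def gaussError (m : ℕ) (b T M B : ℝ) : ℝ :=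
  b * T * (5 * B ^ 2 * ((m + 1) * √T) / 2 + 32 * B ^ 3 * M + B ^ 4 * M ^ 2 / 4)
    + B ^ 2 * |b * T - 1| / 2

section Model

variable {Ω : Type*} {mΩ : MeasurableSpace Ω} {P : Measure Ω} [IsProbabilityMeasure P] {m : ℕ}
  {ϑ g₀ u : Fin (m + 1) → ℝ} {α : ℕ → ℝ} {Y : ℕ → Ω → ℕ}

/-- Telescoping: each step error carries a factor `a ^ 2`, whose sum is at most `b * tailSq α n`;
the surplus powers of `a` are bounded by `M`. -/
lemma norm_setIntegral_interpChar_sub_le (hϑ : ∀ j, 0 < ϑ j)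
    (hg₀ : g₀ ∈ stdSimplex ℝ (Fin (m + 1))) (hα : ∀ n, 1 ≤ n → α n ∈ Set.Ioo (0 : ℝ) 1)
    (hα_sq : Summable fun n : ℕ => α (n + 1) ^ 2) (hY : IsLearningModel P ϑ g₀ α Y)
    {b : ℝ} (hb : 0 ≤ b) (n : ℕ) {M : ℝ} (hM : ∀ k, √b * α (n + 1 + k) ≤ M) {B : ℝ}
    (hu : ∀ j, |u j| ≤ B) {A : Set Ω} (hA : MeasurableSet[natSigma Y n] A) (K : ℕ) :
    ‖∫ ω in A, interpChar ϑ g₀ u α Y b n (n + K) ω ∂P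
        - ∫ ω in A, interpChar ϑ g₀ u α Y b n n ω ∂P‖
      ≤ b * tailSq α n * (5 * B ^ 2 * ((m + 1) * √(tailSq α n)) / 2 + 32 * B ^ 3 * M
        + B ^ 4 * M ^ 2 / 4) * P.real A := by
  have hB : 0 ≤ B := (abs_nonneg _).trans (hu 0)
  have ha : ∀ k, 0 ≤ √b * α (n + 1 + k) := fun k =>
    mul_nonneg (Real.sqrt_nonneg b) (hα (n + 1 + k) (by omega)).1.le
  have hM0 : 0 ≤ M := (ha 0).trans (hM 0)
  set Q := 5 * B ^ 2 * ((m + 1) * √(tailSq α n)) / 2 + 32 * B ^ 3 * M + B ^ 4 * M ^ 2 / 4 with hQ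
  have hQ0 : 0 ≤ Q := by positivity
  have hstep : ‖∫ ω in A, interpChar ϑ g₀ u α Y b n (n + K) ω ∂P
      - ∫ ω in A, interpChar ϑ g₀ u α Y b n n ω ∂P‖
      ≤ (∑ k ∈ Finset.range K, (√b * α (n + 1 + k)) ^ 2 * Q) * P.real A := by
    induction K with
    | zero => simp
    | succ K ih =>
      have h := norm_setIntegral_interpChar_succ_sub_le hϑ hg₀ hα hα_sq hY hb n K hu hA
      rw [show n + K + 1 = n + 1 + K by omega] at h
      rw [Finset.sum_range_succ, add_mul, show n + (K + 1) = n + 1 + K by omega]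
      refine (norm_sub_le_norm_sub_add_norm_sub _ _ _).trans
        ((add_le_add (h.trans ?_) ih).trans_eq (add_comm _ _))
      refine mul_le_mul_of_nonneg_right ?_ measureReal_nonneg
      have h0 := ha K
      have h1 := hM K
      generalize √b * α (n + 1 + K) = a at *
      have h3 : a ^ 2 * (B ^ 3 * a) ≤ a ^ 2 * (B ^ 3 * M) := by gcongr
      have h4 : a ^ 2 * (B ^ 4 * a ^ 2) ≤ a ^ 2 * (B ^ 4 * M ^ 2) := by gcongr
      calc _ = a ^ 2 * (5 * B ^ 2 * ((m + 1) * √(tailSq α n)) / 2)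
            + 32 * (a ^ 2 * (B ^ 3 * a)) + a ^ 2 * (B ^ 4 * a ^ 2) / 4 := by ring
        _ ≤ a ^ 2 * (5 * B ^ 2 * ((m + 1) * √(tailSq α n)) / 2)
            + 32 * (a ^ 2 * (B ^ 3 * M)) + a ^ 2 * (B ^ 4 * M ^ 2) / 4 := by linarith
        _ = a ^ 2 * Q := by rw [hQ]; ring
  refine hstep.trans (mul_le_mul_of_nonneg_right ?_ measureReal_nonneg)
  rw [← Finset.sum_mul]
  simp_rw [mul_pow, Real.sq_sqrt hb, ← Finset.mul_sum]
  gcongr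
  exact sum_range_sq_le_tailSq hα_sq n K

lemma tendsto_dotProduct {g : ℕ → Fin (m + 1) → ℝ} {g' : Fin (m + 1) → ℝ}
    (h : Tendsto g atTop (𝓝 g')) (u : Fin (m + 1) → ℝ) :
    Tendsto (fun n => u ⬝ᵥ g n) atTop (𝓝 (u ⬝ᵥ g')) := by
  unfold dotProduct
  exact tendsto_finsetSum _ fun j _ => ((tendsto_pi_nhds.1 h) j).const_mul _

/-- Along the replacement the remaining tail tends to zero, so the Gaussian factor disappears and
dominated convergence leaves the characteristic function of the full error. -/
lemma tendsto_setIntegral_interpChar (hϑ : ∀ j, 0 < ϑ j)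
    (hg₀ : g₀ ∈ stdSimplex ℝ (Fin (m + 1))) (hα : ∀ n, 1 ≤ n → α n ∈ Set.Ioo (0 : ℝ) 1)
    (hY : IsLearningModel P ϑ g₀ α Y) {gt : Ω → Fin (m + 1) → ℝ}
    (hgt : IsNewtonLimit P ϑ g₀ α Y gt) {b : ℝ} (hb : 0 ≤ b) (n : ℕ) (A : Set Ω) :
    Tendsto (fun K => ∫ ω in A, interpChar ϑ g₀ u α Y b n (n + K) ω ∂P) atTop
      (𝓝 (∫ ω in A, Complex.exp ((√b * (u ⬝ᵥ newton ϑ g₀ α Y n ω - u ⬝ᵥ gt ω) : ℝ)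
        * Complex.I) ∂P)) := by
  refine tendsto_integral_of_dominated_convergence (fun _ => 1)
    (fun K => (integrable_interpChar hϑ hg₀ hα hY hb n _).integrableOn.aestronglyMeasurable)
    (integrable_const _) (fun K => ae_of_all _ fun ω => ?_) (ae_restrict_of_ae ?_)
  · refine norm_exp_mul_I_mul_exp_neg_le _ ?_
    have := postVar_nonneg hϑ (newton_mem_stdSimplex (Y := Y) hϑ hg₀ hα n ω) u
    have := tailSq_nonneg α (n + K)
    positivity
  · filter_upwards [hgt.tendsto] with ω hω
    have hshift : Tendsto (fun K => n + K) atTop atTop := by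
      simpa only [add_comm] using tendsto_add_atTop_nat n
    have h1 := ((tendsto_dotProduct hω u).comp hshift).const_sub (u ⬝ᵥ newton ϑ g₀ α Y n ω)
    have h2 := (((tendsto_tailSq α).comp hshift).const_mul b).const_mul
      (postVar ϑ (newton ϑ g₀ α Y n ω) u)
    rw [mul_zero, mul_zero] at h2
    have h3 := (Complex.continuous_exp.tendsto _).comp
      (((Complex.continuous_ofReal.tendsto _).comp (h1.const_mul √b)).mul_const Complex.I)
    have h4 := (Complex.continuous_ofReal.tendsto _).comp
      ((Real.continuous_exp.tendsto _).comp (h2.div_const 2).neg)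
    rw [zero_div, neg_zero, Real.exp_zero, Complex.ofReal_one] at h4
    have h5 := h3.mul h4
    rw [mul_one] at h5
    exact h5

lemma abs_exp_neg_sub_exp_neg_le {x y : ℝ} (hx : 0 ≤ x) (hy : 0 ≤ y) :
    |Real.exp (-x) - Real.exp (-y)| ≤ |x - y| := by
  wlog h : x ≤ y generalizing x y
  · rw [abs_sub_comm, abs_sub_comm x]
    exact this hy hx (le_of_not_ge h)
  have h1 : Real.exp (-y) ≤ Real.exp (-x) := Real.exp_le_exp.2 (neg_le_neg h)
  rw [abs_of_nonneg (sub_nonneg.2 h1), abs_of_nonpos (sub_nonpos.2 h)]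
  have h2 : Real.exp (-y) = Real.exp (-x) * Real.exp (-(y - x)) := by
    rw [← Real.exp_add]; congr 1; ring
  have h3 := Real.add_one_le_exp (-(y - x))
  have h4 : Real.exp (-x) ≤ 1 := Real.exp_le_one_iff.2 (neg_nonpos.2 hx)
  rw [h2]
  nlinarith [Real.exp_pos (-x), mul_le_mul_of_nonneg_left h3 (Real.exp_pos (-x)).le]

lemma integrable_exp_neg_postVar (hϑ : ∀ j, 0 < ϑ j)
    (hg₀ : g₀ ∈ stdSimplex ℝ (Fin (m + 1))) (hα : ∀ n, 1 ≤ n → α n ∈ Set.Ioo (0 : ℝ) 1)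
    (hY : IsLearningModel P ϑ g₀ α Y) (u : Fin (m + 1) → ℝ) {c : ℝ} (hc : 0 ≤ c) (n : ℕ) :
    Integrable (fun ω => (Real.exp (-(postVar ϑ (newton ϑ g₀ α Y n ω) u * c / 2)) : ℂ)) P := by
  have hv := (measurable_postVar_newton (Y := Y) hϑ hg₀ hα u n).mono (natSigma_le hY n) le_rfl
  refine Integrable.of_bound (Complex.measurable_ofReal.comp (Real.measurable_exp.comp
    ((hv.mul_const _).div_const _).neg)).aestronglyMeasurable 1 (ae_of_all _ fun ω => ?_)
  have := postVar_nonneg hϑ (newton_mem_stdSimplex (Y := Y) hϑ hg₀ hα n ω) u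
  rw [Complex.norm_real, Real.norm_of_nonneg (Real.exp_pos _).le]
  exact Real.exp_le_one_iff.2 (neg_nonpos.2 (by positivity))

/-- The far end of the replacement is the full error; the near end is a pure Gaussian factor with
variance scaled by `b * tailSq α n`, and the last term of `gaussError` pays for replacing this scale
by one. -/
lemma norm_setIntegral_exp_sub_le (hϑ : ∀ j, 0 < ϑ j)
    (hg₀ : g₀ ∈ stdSimplex ℝ (Fin (m + 1))) (hα : ∀ n, 1 ≤ n → α n ∈ Set.Ioo (0 : ℝ) 1)
    (hα_sq : Summable fun n : ℕ => α (n + 1) ^ 2) (hY : IsLearningModel P ϑ g₀ α Y)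
    {gt : Ω → Fin (m + 1) → ℝ} (hgt : IsNewtonLimit P ϑ g₀ α Y gt)
    {b : ℝ} (hb : 0 ≤ b) (n : ℕ) {M : ℝ} (hM : ∀ k, √b * α (n + 1 + k) ≤ M) {B : ℝ}
    (hu : ∀ j, |u j| ≤ B) {A : Set Ω} (hA : MeasurableSet[natSigma Y n] A) :
    ‖∫ ω in A, Complex.exp ((√b * (u ⬝ᵥ newton ϑ g₀ α Y n ω - u ⬝ᵥ gt ω) : ℝ) * Complex.I) ∂P
        - ∫ ω in A, (Real.exp (-(postVar ϑ (newton ϑ g₀ α Y n ω) u / 2)) : ℂ) ∂P‖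
      ≤ gaussError m b (tailSq α n) M B * P.real A := by
  have h1 := le_of_tendsto ((tendsto_setIntegral_interpChar (u := u) hϑ hg₀ hα hY hgt hb n
    A).sub_const
    (∫ ω in A, interpChar ϑ g₀ u α Y b n n ω ∂P)).norm (Eventually.of_forall fun K =>
      norm_setIntegral_interpChar_sub_le hϑ hg₀ hα hα_sq hY hb n hM hu hA K)
  have hT := tailSq_nonneg α n
  have h2 : ‖∫ ω in A, interpChar ϑ g₀ u α Y b n n ω ∂P
      - ∫ ω in A, (Real.exp (-(postVar ϑ (newton ϑ g₀ α Y n ω) u / 2)) : ℂ) ∂P‖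
      ≤ B ^ 2 * |b * tailSq α n - 1| / 2 * P.real A := by
    have hint := (integrable_exp_neg_postVar hϑ hg₀ hα hY u zero_le_one n).integrableOn (s := A)
    simp only [mul_one] at hint
    rw [← integral_sub (integrable_interpChar hϑ hg₀ hα hY hb n n).integrableOn hint]
    refine norm_setIntegral_le_of_norm_le_const (measure_lt_top P A) fun ω _ => ?_
    have hs := newton_mem_stdSimplex (Y := Y) hϑ hg₀ hα n ω
    have hv0 := postVar_nonneg hϑ hs u
    have hvB := postVar_le hϑ hs hu
    simp only [interpChar, sub_self, mul_zero, Complex.ofReal_zero, zero_mul, Complex.exp_zero,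
      one_mul]
    rw [← Complex.ofReal_sub, Complex.norm_real, Real.norm_eq_abs]
    refine (abs_exp_neg_sub_exp_neg_le (by positivity) (by positivity)).trans ?_
    rw [← sub_div, ← mul_sub_one, abs_div, abs_mul, abs_of_nonneg hv0, abs_two]
    gcongr
  rw [gaussError, add_mul]
  exact (norm_sub_le_norm_sub_add_norm_sub _ _ _).trans (add_le_add h1 h2)

/-- A set known at time `n` is known at time `n + 1`, so the previous estimate applies there. The
variance is then moved back one step, at a cost proportional to the rate `α (n + 1)`. -/
lemma norm_setIntegral_exp_sub_pred_le (hϑ : ∀ j, 0 < ϑ j)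
    (hg₀ : g₀ ∈ stdSimplex ℝ (Fin (m + 1))) (hα : ∀ n, 1 ≤ n → α n ∈ Set.Ioo (0 : ℝ) 1)
    (hα_sq : Summable fun n : ℕ => α (n + 1) ^ 2) (hY : IsLearningModel P ϑ g₀ α Y)
    {gt : Ω → Fin (m + 1) → ℝ} (hgt : IsNewtonLimit P ϑ g₀ α Y gt)
    {b : ℝ} (hb : 0 ≤ b) (n : ℕ) {M : ℝ} (hM : ∀ k, √b * α (n + 1 + 1 + k) ≤ M) {B : ℝ}
    (hu : ∀ j, |u j| ≤ B) {A : Set Ω} (hA : MeasurableSet[natSigma Y n] A) :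
    ‖∫ ω in A, Complex.exp ((√b * (u ⬝ᵥ newton ϑ g₀ α Y (n + 1) ω - u ⬝ᵥ gt ω) : ℝ)
          * Complex.I) ∂P
        - ∫ ω in A, (Real.exp (-(postVar ϑ (newton ϑ g₀ α Y n ω) u / 2)) : ℂ) ∂P‖
      ≤ (gaussError m b (tailSq α (n + 1)) M B + 5 * B ^ 2 * ((m + 1) * α (n + 1)) / 2)
        * P.real A := by
  have h1 := norm_setIntegral_exp_sub_le hϑ hg₀ hα hα_sq hY hgt hb (n + 1) hM hu
    (natSigma_mono Y n.le_succ A hA)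
  have h2 : ‖∫ ω in A, (Real.exp (-(postVar ϑ (newton ϑ g₀ α Y (n + 1) ω) u / 2)) : ℂ) ∂P
      - ∫ ω in A, (Real.exp (-(postVar ϑ (newton ϑ g₀ α Y n ω) u / 2)) : ℂ) ∂P‖
      ≤ 5 * B ^ 2 * ((m + 1) * α (n + 1)) / 2 * P.real A := by
    have hint := fun n =>
      (integrable_exp_neg_postVar hϑ hg₀ hα hY u zero_le_one n).integrableOn (s := A)
    simp only [mul_one] at hint
    rw [← integral_sub (hint _) (hint _)]
    refine norm_setIntegral_le_of_norm_le_const (measure_lt_top P A) fun ω _ => ?_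
    have hs := fun n => newton_mem_stdSimplex (Y := Y) hϑ hg₀ hα n ω
    have hv0 := fun n => postVar_nonneg hϑ (hs n) u
    rw [← Complex.ofReal_sub, Complex.norm_real, Real.norm_eq_abs]
    refine (abs_exp_neg_sub_exp_neg_le (div_nonneg (hv0 _) zero_le_two)
      (div_nonneg (hv0 _) zero_le_two)).trans ?_
    rw [← sub_div, abs_div, abs_two]
    gcongr
    refine (abs_postVar_sub_le hϑ (hs _) (hs _) hu).trans ?_
    gcongr
    have hle : ∀ j ∈ Finset.univ, |newton ϑ g₀ α Y (n + 1) ω j - newton ϑ g₀ α Y n ω j|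
        ≤ α (n + 1) := fun j _ => by
      rw [newton_succ_apply, add_sub_cancel_left, abs_mul, abs_of_pos (hα (n + 1) (by omega)).1]
      exact mul_le_of_le_one_right (hα (n + 1) (by omega)).1.le
        (abs_sub_le_one_of_mem_stdSimplex (postMass_mem_stdSimplex hϑ (hs n) _) (hs n) j)
    refine (Finset.sum_le_sum hle).trans_eq ?_
    simp
  rw [add_mul]
  exact (norm_sub_le_norm_sub_add_norm_sub _ _ _).trans (add_le_add h1 h2)

end Model

/-! ### From bounds on set integrals to conditional laws -/

section CondExp

variable {Ω : Type*} {𝒢 mΩ : MeasurableSpace Ω} {P : Measure Ω}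

lemma ae_re_le_of_norm_setIntegral_le [IsFiniteMeasure P] (hle : 𝒢 ≤ mΩ)
    {D : Ω → ℂ} (hD : StronglyMeasurable[𝒢] D) (hint : Integrable D P) {ε : ℝ}
    (h : ∀ A, MeasurableSet[𝒢] A → ‖∫ ω in A, D ω ∂P‖ ≤ ε * P.real A) :
    ∀ᵐ ω ∂P, (D ω).re ≤ ε := by
  have hre : StronglyMeasurable[𝒢] fun ω => (D ω).re :=
    Complex.continuous_re.comp_stronglyMeasurable hD
  refine ae_of_ae_trim hle (ae_le_of_forall_setIntegral_le (hint.re.trim hle hre)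
    (integrable_const ε) fun A hA _ => ?_)
  have h1 : ∫ ω in A, (D ω).re ∂P = (∫ ω in A, D ω ∂P).re := integral_re hint.integrableOn
  have h2 : (P.trim hle).real A = P.real A := by
    rw [measureReal_def, trim_measurableSet_eq hle hA, measureReal_def]
  change ∫ ω in A, (D ω).re ∂P.trim hle ≤ _
  rw [← setIntegral_trim hle hre hA, setIntegral_const, h2, h1, smul_eq_mul, mul_comm]
  exact (Complex.re_le_norm _).trans (h A hA)

/-- Rotating by the four units `±1`, `±I` reduces to real parts; the factor two comes from adding
the bounds on the real and imaginary parts. -/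
lemma ae_norm_le_of_norm_setIntegral_le [IsFiniteMeasure P] (hle : 𝒢 ≤ mΩ)
    {D : Ω → ℂ} (hD : StronglyMeasurable[𝒢] D) (hint : Integrable D P) {ε : ℝ}
    (h : ∀ A, MeasurableSet[𝒢] A → ‖∫ ω in A, D ω ∂P‖ ≤ ε * P.real A) :
    ∀ᵐ ω ∂P, ‖D ω‖ ≤ 2 * ε := by
  have key : ∀ c : ℂ, ‖c‖ = 1 → ∀ᵐ ω ∂P, (c * D ω).re ≤ ε := fun c hc =>
    ae_re_le_of_norm_setIntegral_le hle (hD.const_mul c) (hint.const_mul c) fun A hA => by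
      rw [integral_const_mul, norm_mul, hc, one_mul]
      exact h A hA
  filter_upwards [key 1 (by simp), key (-1) (by simp), key Complex.I (by simp),
    key (-Complex.I) (by simp)] with ω h1 h2 h3 h4
  refine (Complex.norm_le_abs_re_add_abs_im _).trans ?_
  simp only [Complex.mul_re, Complex.neg_re, Complex.neg_im, Complex.one_re, Complex.one_im,
    Complex.I_re, Complex.I_im] at h1 h2 h3 h4
  rw [two_mul]
  refine add_le_add (abs_le.2 ⟨?_, ?_⟩) (abs_le.2 ⟨?_, ?_⟩) <;> linarith

variable {m : ℕ}

lemma continuous_charFun_of_isFiniteMeasure (μ : Measure (EuclideanSpace ℝ (Fin m)))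
    [IsFiniteMeasure μ] : Continuous (charFun μ) := by
  have h : charFun μ = fun t => ∫ x, Complex.exp (inner ℝ x t * Complex.I) ∂μ := by
    ext t; exact charFun_apply t
  rw [h]
  refine continuous_of_dominated (bound := fun _ => 1) (fun t => ?_)
    (fun t => ae_of_all _ fun x => (Complex.norm_exp_ofReal_mul_I _).le) (integrable_const _)
    (ae_of_all _ fun x => ?_)
  · exact (by fun_prop : Measurable _).aestronglyMeasurable
  · fun_prop

lemma charFun_condLaw_ae_eq [IsFiniteMeasure P] (hle : 𝒢 ≤ mΩ)
    {X : Ω → EuclideanSpace ℝ (Fin m)} (hX : Measurable X) (t : EuclideanSpace ℝ (Fin m)) :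
    P[fun ω => Complex.exp (inner ℝ (X ω) t * Complex.I) | 𝒢]
      =ᵐ[P] fun ω => charFun (condLaw P 𝒢 X ω : Measure (EuclideanSpace ℝ (Fin m))) t := by
  have hf : StronglyMeasurable fun x : EuclideanSpace ℝ (Fin m) =>
      Complex.exp (inner ℝ x t * Complex.I) :=
    (by fun_prop : Measurable _).stronglyMeasurable
  have h := condExp_ae_eq_integral_condDistrib (mβ := 𝒢) (X := fun ω : Ω => ω) (μ := P)
    (measurable_id'' hle) hX.aemeasurable hf
    (Integrable.of_bound (hf.measurable.comp hX).aestronglyMeasurable 1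
      (ae_of_all _ fun ω => (Complex.norm_exp_ofReal_mul_I _).le))
  have hcomap : MeasurableSpace.comap (fun ω : Ω => ω) 𝒢 = 𝒢 := MeasurableSpace.comap_id
  rw [hcomap] at h
  filter_upwards [h] with ω hω
  rw [hω, charFun_apply]
  rfl

/-- For fixed frequency the bound holds off a null set, which depends on the frequency. Restricting
to a countable dense set gives one null set, and continuity in `t` of all three terms extends the
bound to every frequency before Lévy's theorem is applied. -/
lemma almostSureCondConv_of_charFun [IsProbabilityMeasure P] {ℱ : ℕ → MeasurableSpace Ω}
    (hle : ∀ n, ℱ n ≤ mΩ) {X : ℕ → Ω → EuclideanSpace ℝ (Fin m)} (hX : ∀ n, Measurable (X n))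
    (K : Kernel Ω (EuclideanSpace ℝ (Fin m))) [IsMarkovKernel K]
    {ψ : ℕ → Ω → EuclideanSpace ℝ (Fin m) → ℂ} (hψc : ∀ n ω, Continuous (ψ n ω))
    (hψm : ∀ n t, StronglyMeasurable[ℱ n] fun ω => ψ n ω t)
    (hψi : ∀ n t, Integrable (fun ω => ψ n ω t) P)
    (hψ : ∀ᵐ ω ∂P, ∀ t, Tendsto (fun n => ψ n ω t) atTop (𝓝 (charFun (K ω) t)))
    {ε : ℕ → EuclideanSpace ℝ (Fin m) → ℝ} (hεc : ∀ n, Continuous (ε n))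
    (hε : ∀ t, Tendsto (fun n => ε n t) atTop (𝓝 0))
    (hbound : ∀ n, 1 ≤ n → ∀ t A, MeasurableSet[ℱ n] A →
      ‖∫ ω in A, Complex.exp (inner ℝ (X n ω) t * Complex.I) ∂P - ∫ ω in A, ψ n ω t ∂P‖
        ≤ ε n t * P.real A) :
    AlmostSureCondConv P ℱ X K := by
  have hexp : ∀ n t, Integrable (fun ω => Complex.exp (inner ℝ (X n ω) t * Complex.I)) P :=
    fun n t => Integrable.of_bound
      (by have := hX n; fun_prop : Measurable _).aestronglyMeasurable 1
      (ae_of_all _ fun ω => (Complex.norm_exp_ofReal_mul_I _).le)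
  have h1 : ∀ n, 1 ≤ n → ∀ t, ∀ᵐ ω ∂P,
      ‖charFun (condLaw P (ℱ n) (X n) ω : Measure (EuclideanSpace ℝ (Fin m))) t - ψ n ω t‖
        ≤ 2 * ε n t := by
    intro n hn t
    have h := ae_norm_le_of_norm_setIntegral_le (hle n) (ε := ε n t)
      (stronglyMeasurable_condExp.sub (hψm n t))
      (integrable_condExp.sub (hψi n t)) (D := P[fun ω => Complex.exp
        (inner ℝ (X n ω) t * Complex.I) | ℱ n] - fun ω => ψ n ω t) fun A hA => by
          rw [integral_sub' integrable_condExp.integrableOn (hψi n t).integrableOn,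
            setIntegral_condExp (hle n) (hexp n t) hA]
          exact hbound n hn t A hA
    filter_upwards [h, charFun_condLaw_ae_eq (hle n) (hX n) t] with ω hω hω'
    rwa [Pi.sub_apply, hω'] at hω
  obtain ⟨D, hDc, hDd⟩ := TopologicalSpace.exists_countable_dense (EuclideanSpace ℝ (Fin m))
  have h2 : ∀ᵐ ω ∂P, ∀ n, 1 ≤ n → ∀ t ∈ D,
      ‖charFun (condLaw P (ℱ n) (X n) ω : Measure (EuclideanSpace ℝ (Fin m))) t - ψ n ω t‖
        ≤ 2 * ε n t := by
    rw [ae_all_iff]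
    intro n
    rw [eventually_imp_distrib_left]
    intro hn
    exact (ae_ball_iff hDc).2 fun t _ => h1 n hn t
  rw [AlmostSureCondConv]
  filter_upwards [h2, hψ] with ω hω hω'
  refine ProbabilityMeasure.tendsto_of_tendsto_charFun fun t => ?_
  have h3 : ∀ n, 1 ≤ n →
      ‖charFun (condLaw P (ℱ n) (X n) ω : Measure (EuclideanSpace ℝ (Fin m))) t - ψ n ω t‖
        ≤ 2 * ε n t := by
    intro n hn
    have hcl : IsClosed {t | ‖charFun (condLaw P (ℱ n) (X n) ω :
        Measure (EuclideanSpace ℝ (Fin m))) t - ψ n ω t‖ ≤ 2 * ε n t} :=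
      isClosed_le ((continuous_charFun_of_isFiniteMeasure _).sub (hψc n ω)).norm
        ((hεc n).const_mul 2)
    exact hcl.closure_subset_iff.2 (fun t ht => hω n hn t ht) (hDd t)
  have h4 : Tendsto (fun n =>
      charFun (condLaw P (ℱ n) (X n) ω : Measure (EuclideanSpace ℝ (Fin m))) t - ψ n ω t)
      atTop (𝓝 0) := by
    refine squeeze_zero_norm' ?_ (by simpa using (hε t).const_mul 2)
    filter_upwards [eventually_ge_atTop 1] with n hn using h3 n hn
  have h5 := h4.add (hω' t)
  rw [zero_add] at h5
  exact h5.congr fun n => sub_add_cancel _ _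

end CondExp

/-! ### The limiting Gaussian kernel -/

section Gaussian

variable {m : ℕ} {ϑ : Fin (m + 1) → ℝ}

/-- A vector of `ℝ ^ m` as a test vector on the grid, vanishing at the last grid point. -/
def testVec (t : EuclideanSpace ℝ (Fin m)) : Fin (m + 1) → ℝ := Fin.snoc (fun i => t i) 0

lemma abs_testVec_le (t : EuclideanSpace ℝ (Fin m)) (j : Fin (m + 1)) : |testVec t j| ≤ ‖t‖ := by
  refine Fin.lastCases ?_ (fun i => ?_) j
  · simp [testVec]
  · simpa [testVec] using PiLp.norm_apply_le t i

lemma charFun_multivariateGaussian_covMatrix (hϑ : ∀ j, 0 < ϑ j) {g : Fin (m + 1) → ℝ}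
    (hg : g ∈ stdSimplex ℝ (Fin (m + 1))) (t : EuclideanSpace ℝ (Fin m)) :
    charFun (multivariateGaussian 0 (covMatrix ϑ g)) t
      = (Real.exp (-(postVar ϑ g (testVec t) / 2)) : ℂ) := by
  rw [charFun_multivariateGaussian (posSemidef_covMatrix hϑ hg), testVec,
    ← dotProduct_covMatrix_mulVec hϑ hg]
  simp only [inner_zero_right, Complex.ofReal_zero, zero_mul, zero_sub]
  push_cast
  rfl

lemma tendsto_postVar {ι : Type*} {l : Filter ι} (hϑ : ∀ j, 0 < ϑ j) (u : Fin (m + 1) → ℝ)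
    {g : ι → Fin (m + 1) → ℝ} {g' : Fin (m + 1) → ℝ}
    (hg : ∀ n, g n ∈ stdSimplex ℝ (Fin (m + 1))) (hg' : g' ∈ stdSimplex ℝ (Fin (m + 1)))
    (h : Tendsto g l (𝓝 g')) :
    Tendsto (fun n => postVar ϑ (g n) u) l (𝓝 (postVar ϑ g' u)) := by
  obtain ⟨B, hB⟩ := exists_abs_le u
  rw [tendsto_iff_norm_sub_tendsto_zero]
  have h1 : Tendsto (fun n => 5 * B ^ 2 * ∑ j, |g n j - g' j|) l
      (𝓝 (5 * B ^ 2 * ∑ j, |g' j - g' j|)) :=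
    (tendsto_finsetSum _ fun j _ => (((tendsto_pi_nhds.1 h) j).sub_const _).abs).const_mul _
  simp only [sub_self, abs_zero, Finset.sum_const_zero, mul_zero] at h1
  exact squeeze_zero (fun n => norm_nonneg _)
    (fun n => abs_postVar_sub_le hϑ (hg n) hg' hB) h1

lemma tendsto_charFun_covMatrix {ι : Type*} {l : Filter ι} (hϑ : ∀ j, 0 < ϑ j)
    {g : ι → Fin (m + 1) → ℝ} {g' : Fin (m + 1) → ℝ}
    (hg : ∀ n, g n ∈ stdSimplex ℝ (Fin (m + 1))) (hg' : g' ∈ stdSimplex ℝ (Fin (m + 1)))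
    (h : Tendsto g l (𝓝 g')) (t : EuclideanSpace ℝ (Fin m)) :
    Tendsto (fun n => charFun (multivariateGaussian 0 (covMatrix ϑ (g n))) t) l
      (𝓝 (charFun (multivariateGaussian 0 (covMatrix ϑ g')) t)) := by
  simp_rw [fun n => charFun_multivariateGaussian_covMatrix hϑ (hg n) t,
    charFun_multivariateGaussian_covMatrix hϑ hg' t]
  exact (Complex.continuous_ofReal.tendsto _).comp ((Real.continuous_exp.tendsto _).comp
    ((tendsto_postVar hϑ _ hg hg' h).div_const 2).neg)

/-- The Gaussian law with covariance `V_g`, for `g` in the simplex. -/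
noncomputable def gaussLaw (ϑ : Fin (m + 1) → ℝ) (g : stdSimplex ℝ (Fin (m + 1))) :
    ProbabilityMeasure (EuclideanSpace ℝ (Fin m)) :=
  ⟨multivariateGaussian 0 (covMatrix ϑ g), inferInstance⟩

/-- Characteristic functions depend continuously on `g` through the variance. Weak continuity is
what makes the limit a measurable kernel. -/
lemma continuous_gaussLaw (hϑ : ∀ j, 0 < ϑ j) : Continuous (gaussLaw ϑ) := by
  refine continuous_iff_seqContinuous.2 fun g g' h => ?_
  refine ProbabilityMeasure.tendsto_of_tendsto_charFun fun t => ?_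
  exact tendsto_charFun_covMatrix hϑ (fun n => (g n).2) g'.2
    ((continuous_subtype_val.tendsto _).comp h) t

/-- Closed sets form a generating pi-system, and the measure of a closed set is a limit of integrals
of bounded continuous functions. -/
lemma measurable_toMeasure_of_continuous {S E : Type*} [TopologicalSpace S] [MeasurableSpace S]
    [OpensMeasurableSpace S] [TopologicalSpace E] [HasOuterApproxClosed E] [MeasurableSpace E]
    [BorelSpace E] {f : S → ProbabilityMeasure E} (hf : Continuous f) :
    Measurable fun s => (f s : Measure E) := by
  refine Measurable.measure_of_isPiSystem_of_isProbabilityMeasure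
    (BorelSpace.measurable_eq.trans borel_eq_generateFrom_isClosed) isPiSystem_isClosed
    fun F hF => ?_
  refine measurable_of_tendsto_metrizable (fun n => ?_) (tendsto_pi_nhds.2 fun s =>
    HasOuterApproxClosed.tendsto_lintegral_apprSeq hF (f s : Measure E))
  exact ((ProbabilityMeasure.continuous_lintegral_boundedContinuousFunction _).comp hf).measurable

lemma exists_gaussKernel {Ω : Type*} [MeasurableSpace Ω] (hϑ : ∀ j, 0 < ϑ j)
    {gt : Ω → Fin (m + 1) → ℝ} (hgt : Measurable gt)
    (hs : ∀ ω, gt ω ∈ stdSimplex ℝ (Fin (m + 1))) :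
    ∃ (K : Kernel Ω (EuclideanSpace ℝ (Fin m))) (_ : IsMarkovKernel K),
      ∀ ω, K ω = multivariateGaussian 0 (covMatrix ϑ (gt ω)) := by
  have hm : Measurable fun ω => (gaussLaw ϑ ⟨gt ω, hs ω⟩ : Measure (EuclideanSpace ℝ (Fin m))) :=
    (measurable_toMeasure_of_continuous (continuous_gaussLaw hϑ)).comp (hgt.subtype_mk (h := hs))
  exact ⟨⟨_, hm⟩, ⟨fun ω => (gaussLaw ϑ ⟨gt ω, hs ω⟩).2⟩, fun _ => rfl⟩

end Gaussian

/-! ### Asymptotics of the rates and of the error bound -/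

section Rates

variable {α b : ℕ → ℝ}

lemma tendsto_rate (hα : ∀ n, 1 ≤ n → α n ∈ Set.Ioo (0 : ℝ) 1)
    (hα_sq : Summable fun n : ℕ => α (n + 1) ^ 2) :
    Tendsto (fun n => α (n + 1)) atTop (𝓝 0) := by
  have h := (Real.continuous_sqrt.tendsto 0).comp hα_sq.tendsto_atTop_zero
  rw [Real.sqrt_zero] at h
  exact h.congr fun n => Real.sqrt_sq (hα (n + 1) (by omega)).1.le

lemma sq_le_iSup_sq (hα : ∀ n, 1 ≤ n → α n ∈ Set.Ioo (0 : ℝ) 1) {n : ℕ} (hn : 1 ≤ n) (k : ℕ) :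
    α (n + k) ^ 2 ≤ ⨆ k : ℕ, α (n + k) ^ 2 := by
  refine le_ciSup (f := fun k => α (n + k) ^ 2) ⟨1, ?_⟩ k
  rintro _ ⟨l, rfl⟩
  have h := hα (n + l) (by omega)
  exact pow_le_one₀ h.1.le h.2.le

/-- The bound `(b_n sup_{k ≥ n} α_k ^ 2) ^ (1 / 2)` on the rescaled learning rates. -/
noncomputable def rateBound (α b : ℕ → ℝ) (n : ℕ) : ℝ := √(b n * ⨆ k : ℕ, α (n + k) ^ 2)

lemma sqrt_mul_rate_le (hα : ∀ n, 1 ≤ n → α n ∈ Set.Ioo (0 : ℝ) 1)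
    (hb_pos : ∀ n, 1 ≤ n → 0 < b n) {n : ℕ} (hn : 1 ≤ n) (k : ℕ) :
    √(b n) * α (n + 1 + k) ≤ rateBound α b n := by
  have hk := (hα (n + 1 + k) (by omega)).1.le
  have hb := (hb_pos n hn).le
  refine Real.le_sqrt_of_sq_le ?_
  rw [mul_pow, Real.sq_sqrt hb]
  refine mul_le_mul_of_nonneg_left ?_ hb
  have h := sq_le_iSup_sq hα hn (1 + k)
  rwa [← add_assoc] at h

lemma tendsto_rateBound (hb_sup : Tendsto (fun n => b n * ⨆ k : ℕ, α (n + k) ^ 2) atTop (𝓝 0)) :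
    Tendsto (rateBound α b) atTop (𝓝 0) := by
  have h := (Real.continuous_sqrt.tendsto 0).comp hb_sup
  rwa [Real.sqrt_zero] at h

/-- The assumed tail starts at index `n`, while the increments after time `n` start at `n + 1`. The
difference `b n * α n ^ 2` vanishes by the condition on the supremum. -/
lemma tendsto_mul_tailSq (hα : ∀ n, 1 ≤ n → α n ∈ Set.Ioo (0 : ℝ) 1)
    (hα_sq : Summable fun n : ℕ => α (n + 1) ^ 2) (hb_pos : ∀ n, 1 ≤ n → 0 < b n)
    (hb_sup : Tendsto (fun n => b n * ⨆ k : ℕ, α (n + k) ^ 2) atTop (𝓝 0))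
    (hb_tail : Tendsto (fun n => b n * ∑' k : ℕ, α (n + k) ^ 2) atTop (𝓝 1)) :
    Tendsto (fun n => b n * tailSq α n) atTop (𝓝 1) := by
  have h0 : Tendsto (fun n => b n * α n ^ 2) atTop (𝓝 0) := by
    refine squeeze_zero' ?_ ?_ hb_sup
    · filter_upwards [eventually_ge_atTop 1] with n hn
      exact mul_nonneg (hb_pos n hn).le (sq_nonneg _)
    · filter_upwards [eventually_ge_atTop 1] with n hn
      exact mul_le_mul_of_nonneg_left (sq_le_iSup_sq hα hn 0) (hb_pos n hn).le
  have h1 := hb_tail.sub h0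
  rw [sub_zero] at h1
  refine h1.congr' ?_
  filter_upwards [eventually_ge_atTop 1] with n hn
  obtain ⟨n, rfl⟩ := Nat.exists_eq_add_of_le' hn
  have h2 := tailSq_eq_add hα_sq n
  rw [tailSq] at h2
  rw [h2]
  ring

lemma tendsto_gaussError (m : ℕ) (hα : ∀ n, 1 ≤ n → α n ∈ Set.Ioo (0 : ℝ) 1)
    (hα_sq : Summable fun n : ℕ => α (n + 1) ^ 2) (hb_pos : ∀ n, 1 ≤ n → 0 < b n)
    (hb_sup : Tendsto (fun n => b n * ⨆ k : ℕ, α (n + k) ^ 2) atTop (𝓝 0))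
    (hb_tail : Tendsto (fun n => b n * ∑' k : ℕ, α (n + k) ^ 2) atTop (𝓝 1)) (B : ℝ) :
    Tendsto (fun n => gaussError m (b n) (tailSq α n) (rateBound α b n) B) atTop (𝓝 0) := by
  have hτ := tendsto_mul_tailSq hα hα_sq hb_pos hb_sup hb_tail
  have hT := (Real.continuous_sqrt.tendsto 0).comp (tendsto_tailSq α)
  rw [Real.sqrt_zero] at hT
  have hM := tendsto_rateBound hb_sup
  have h1 := (hτ.mul (((((hT.const_mul ((m : ℝ) + 1)).const_mul (5 * B ^ 2)).div_const 2).add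
    (hM.const_mul (32 * B ^ 3))).add (((hM.pow 2).const_mul (B ^ 4)).div_const 4))).add
    ((((hτ.sub_const 1).abs).const_mul (B ^ 2)).div_const 2)
  simpa [gaussError] using h1

end Rates

/-! ### Conditional convergence of the rescaled error -/

section Model

variable {Ω : Type*} {mΩ : MeasurableSpace Ω} {P : Measure Ω} {m : ℕ}
  {ϑ g₀ : Fin (m + 1) → ℝ} {α b : ℕ → ℝ} {Y : ℕ → Ω → ℕ} {gt : Ω → Fin (m + 1) → ℝ}

lemma inner_scaledError (n : ℕ) (ω : Ω) (t : EuclideanSpace ℝ (Fin m)) :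
    inner ℝ (scaledError ϑ g₀ α b Y gt n ω) t
      = √(b n) * (testVec t ⬝ᵥ newton ϑ g₀ α Y n ω - testVec t ⬝ᵥ gt ω) := by
  rw [testVec, dotProduct_snoc_zero, dotProduct_snoc_zero, ← Finset.sum_sub_distrib,
    Finset.mul_sum, PiLp.inner_apply]
  refine Finset.sum_congr rfl fun i _ => ?_
  simp [scaledError]
  ring

lemma measurable_scaledError (hY : IsLearningModel P ϑ g₀ α Y) (hgt : Measurable gt) (n : ℕ) :
    Measurable (scaledError ϑ g₀ α b Y gt n) := by
  have h := fun j => (measurable_newton_apply ϑ g₀ α Y n j).mono (natSigma_le hY n) le_rfl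
  exact (WithLp.measurable_toLp 2 _).comp (measurable_pi_lambda _ fun i =>
    ((h _).sub ((measurable_pi_apply _).comp hgt)).const_mul _)

variable [IsProbabilityMeasure P]

lemma almostSureCondConv_of_gaussian_bound (hϑ : ∀ j, 0 < ϑ j)
    (hg₀ : g₀ ∈ stdSimplex ℝ (Fin (m + 1))) (hα : ∀ n, 1 ≤ n → α n ∈ Set.Ioo (0 : ℝ) 1)
    (hY : IsLearningModel P ϑ g₀ α Y) (hgt : IsNewtonLimit P ϑ g₀ α Y gt)
    (K : Kernel Ω (EuclideanSpace ℝ (Fin m))) [IsMarkovKernel K]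
    (hK : ∀ ω, K ω = multivariateGaussian 0 (covMatrix ϑ (gt ω)))
    {X : ℕ → Ω → EuclideanSpace ℝ (Fin m)} (hX : ∀ n, Measurable (X n))
    {ε : ℕ → EuclideanSpace ℝ (Fin m) → ℝ} (hεc : ∀ n, Continuous (ε n))
    (hε : ∀ t, Tendsto (fun n => ε n t) atTop (𝓝 0))
    (hbound : ∀ n, 1 ≤ n → ∀ t A, MeasurableSet[natSigma Y n] A →
      ‖∫ ω in A, Complex.exp (inner ℝ (X n ω) t * Complex.I) ∂P
        - ∫ ω in A, (Real.exp (-(postVar ϑ (newton ϑ g₀ α Y n ω) (testVec t) / 2)) : ℂ) ∂P‖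
        ≤ ε n t * P.real A) :
    AlmostSureCondConv P (natSigma Y) X K := by
  have hs := fun n ω => newton_mem_stdSimplex (Y := Y) hϑ hg₀ hα n ω
  have hψ : ∀ n ω t, charFun (multivariateGaussian 0 (covMatrix ϑ (newton ϑ g₀ α Y n ω))) t
      = (Real.exp (-(postVar ϑ (newton ϑ g₀ α Y n ω) (testVec t) / 2)) : ℂ) := fun n ω t =>
    charFun_multivariateGaussian_covMatrix hϑ (hs n ω) t
  refine almostSureCondConv_of_charFun (natSigma_le hY) hX K
    (ψ := fun n ω => charFun (multivariateGaussian 0 (covMatrix ϑ (newton ϑ g₀ α Y n ω))))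
    (fun n ω => continuous_charFun_of_isFiniteMeasure _) (fun n t => ?_) (fun n t => ?_) ?_ hεc hε
    fun n hn t A hA => ?_
  · simp_rw [hψ]
    refine Measurable.stronglyMeasurable ?_
    exact Complex.measurable_ofReal.comp (Real.measurable_exp.comp
      ((measurable_postVar_newton hϑ hg₀ hα _ n).div_const _).neg)
  · simp_rw [hψ]
    simpa only [mul_one] using integrable_exp_neg_postVar hϑ hg₀ hα hY (testVec t) zero_le_one n
  · filter_upwards [hgt.tendsto] with ω hω t
    rw [hK]
    exact tendsto_charFun_covMatrix hϑ (fun n => hs n ω) (hgt.pmf ω) hω t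
  · simp_rw [hψ]
    exact hbound n hn t A hA

lemma continuous_gaussError (c T M : ℝ) :
    Continuous fun t : EuclideanSpace ℝ (Fin m) => gaussError m c T M ‖t‖ := by
  unfold gaussError
  fun_prop

lemma almostSureCondConv_scaledError (hϑ : ∀ j, 0 < ϑ j)
    (hg₀ : g₀ ∈ stdSimplex ℝ (Fin (m + 1))) (hα : ∀ n, 1 ≤ n → α n ∈ Set.Ioo (0 : ℝ) 1)
    (hα_sq : Summable fun n : ℕ => α (n + 1) ^ 2) (hY : IsLearningModel P ϑ g₀ α Y)
    (hgt : IsNewtonLimit P ϑ g₀ α Y gt) (hb_pos : ∀ n, 1 ≤ n → 0 < b n)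
    (hb_sup : Tendsto (fun n => b n * ⨆ k : ℕ, α (n + k) ^ 2) atTop (𝓝 0))
    (hb_tail : Tendsto (fun n => b n * ∑' k : ℕ, α (n + k) ^ 2) atTop (𝓝 1))
    (K : Kernel Ω (EuclideanSpace ℝ (Fin m))) [IsMarkovKernel K]
    (hK : ∀ ω, K ω = multivariateGaussian 0 (covMatrix ϑ (gt ω))) :
    AlmostSureCondConv P (natSigma Y) (scaledError ϑ g₀ α b Y gt) K := by
  refine almostSureCondConv_of_gaussian_bound hϑ hg₀ hα hY hgt K hK
    (measurable_scaledError hY hgt.measurable)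
    (ε := fun n t => gaussError m (b n) (tailSq α n) (rateBound α b n) ‖t‖)
    (fun n => continuous_gaussError _ _ _)
    (fun t => tendsto_gaussError m hα hα_sq hb_pos hb_sup hb_tail ‖t‖) fun n hn t A hA => ?_
  simp_rw [inner_scaledError]
  exact norm_setIntegral_exp_sub_le hϑ hg₀ hα hα_sq hY hgt (hb_pos n hn).le n
    (sqrt_mul_rate_le hα hb_pos hn) (abs_testVec_le t) hA

lemma almostSureCondConv_scaledError_succ (hϑ : ∀ j, 0 < ϑ j)
    (hg₀ : g₀ ∈ stdSimplex ℝ (Fin (m + 1))) (hα : ∀ n, 1 ≤ n → α n ∈ Set.Ioo (0 : ℝ) 1)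
    (hα_sq : Summable fun n : ℕ => α (n + 1) ^ 2) (hY : IsLearningModel P ϑ g₀ α Y)
    (hgt : IsNewtonLimit P ϑ g₀ α Y gt) (hb_pos : ∀ n, 1 ≤ n → 0 < b n)
    (hb_sup : Tendsto (fun n => b n * ⨆ k : ℕ, α (n + k) ^ 2) atTop (𝓝 0))
    (hb_tail : Tendsto (fun n => b n * ∑' k : ℕ, α (n + k) ^ 2) atTop (𝓝 1))
    (K : Kernel Ω (EuclideanSpace ℝ (Fin m))) [IsMarkovKernel K]
    (hK : ∀ ω, K ω = multivariateGaussian 0 (covMatrix ϑ (gt ω))) :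
    AlmostSureCondConv P (natSigma Y) (fun n => scaledError ϑ g₀ α b Y gt (n + 1)) K := by
  refine almostSureCondConv_of_gaussian_bound hϑ hg₀ hα hY hgt K hK
    (fun n => measurable_scaledError hY hgt.measurable (n + 1))
    (ε := fun n t => gaussError m (b (n + 1)) (tailSq α (n + 1)) (rateBound α b (n + 1)) ‖t‖
      + 5 * ‖t‖ ^ 2 * ((m + 1) * α (n + 1)) / 2)
    (fun n => (continuous_gaussError _ _ _).add (by fun_prop)) (fun t => ?_) fun n hn t A hA => ?_
  · have h := ((tendsto_gaussError m hα hα_sq hb_pos hb_sup hb_tail ‖t‖).comp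
      (tendsto_add_atTop_nat 1)).add
      ((((tendsto_rate hα hα_sq).const_mul ((m : ℝ) + 1)).const_mul (5 * ‖t‖ ^ 2)).div_const 2)
    simpa using h
  · simp_rw [inner_scaledError]
    exact norm_setIntegral_exp_sub_pred_le hϑ hg₀ hα hα_sq hY hgt (hb_pos (n + 1) (by omega)).le n
      (sqrt_mul_rate_le hα hb_pos (by omega)) (abs_testVec_le t) hA

/-! ### Positivity of the limiting masses -/

lemma exists_pos_le_newton_apply (hϑ : ∀ j, 0 < ϑ j)
    (hg₀ : g₀ ∈ stdSimplex ℝ (Fin (m + 1))) (hα : ∀ n, 1 ≤ n → α n ∈ Set.Ioo (0 : ℝ) 1)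
    {j : Fin (m + 1)} (hj : 0 < g₀ j) (n : ℕ) :
    ∃ c, 0 < c ∧ ∀ ω, c ≤ newton ϑ g₀ α Y n ω j := by
  induction n with
  | zero => exact ⟨g₀ j, hj, fun _ => le_rfl⟩
  | succ n ih =>
    obtain ⟨c, hc, h⟩ := ih
    have ha := hα (n + 1) (by omega)
    refine ⟨(1 - α (n + 1)) * c, mul_pos (sub_pos.2 ha.2) hc, fun ω => ?_⟩
    have hs := newton_mem_stdSimplex (Y := Y) hϑ hg₀ hα n ω
    exact (mul_le_mul_of_nonneg_left (h ω) (sub_pos.2 ha.2).le).trans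
      (le_add_of_nonneg_right (mul_nonneg ha.1.le ((postMass_mem_stdSimplex hϑ hs _).1 j)))

lemma integrable_inv_newton_apply (hϑ : ∀ j, 0 < ϑ j)
    (hg₀ : g₀ ∈ stdSimplex ℝ (Fin (m + 1))) (hα : ∀ n, 1 ≤ n → α n ∈ Set.Ioo (0 : ℝ) 1)
    (hY : IsLearningModel P ϑ g₀ α Y) {j : Fin (m + 1)} (hj : 0 < g₀ j) (n : ℕ) :
    Integrable (fun ω => (newton ϑ g₀ α Y n ω j)⁻¹) P := by
  obtain ⟨c, hc, h⟩ := exists_pos_le_newton_apply (Y := Y) hϑ hg₀ hα hj n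
  refine Integrable.of_bound
    ((measurable_newton_apply ϑ g₀ α Y n j).mono (natSigma_le hY n) le_rfl).inv.aestronglyMeasurable
    c⁻¹ (ae_of_all _ fun ω => ?_)
  rw [Real.norm_of_nonneg (inv_nonneg.2 (hc.le.trans (h ω)))]
  exact inv_anti₀ hc (h ω)

lemma integral_inv_newton_succ_le (hϑ : ∀ j, 0 < ϑ j)
    (hg₀ : g₀ ∈ stdSimplex ℝ (Fin (m + 1))) (hα : ∀ n, 1 ≤ n → α n ∈ Set.Ioo (0 : ℝ) 1)
    (hY : IsLearningModel P ϑ g₀ α Y) {j : Fin (m + 1)} (hj : 0 < g₀ j) {C : ℝ}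
    (hC : ∀ g ∈ stdSimplex ℝ (Fin (m + 1)),
      Summable (fun y => poisKernel (ϑ j) y ^ 2 / mixture ϑ g y) ∧
      ∑' y, poisKernel (ϑ j) y ^ 2 / mixture ϑ g y ≤ C)
    (n : ℕ) (hn : α (n + 1) ≤ 1 / 2) :
    ∫ ω, (newton ϑ g₀ α Y (n + 1) ω j)⁻¹ ∂P
      ≤ (1 + 2 * C * α (n + 1) ^ 2) * ∫ ω, (newton ϑ g₀ α Y n ω j)⁻¹ ∂P := by
  obtain ⟨c, hc, h⟩ := exists_pos_le_newton_apply (Y := Y) hϑ hg₀ hα hj n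
  have hs := fun ω => newton_mem_stdSimplex (Y := Y) hϑ hg₀ hα n ω
  have ha := hα (n + 1) (by omega)
  have hlow : ∀ ω y, (1 - α (n + 1)) * c ≤ (1 - α (n + 1)) * newton ϑ g₀ α Y n ω j
      + α (n + 1) * postMass ϑ (newton ϑ g₀ α Y n ω) y j := fun ω y =>
    (mul_le_mul_of_nonneg_left (h ω) (sub_pos.2 ha.2).le).trans
      (le_add_of_nonneg_right (mul_nonneg ha.1.le ((postMass_mem_stdSimplex hϑ (hs ω) _).1 j)))
  have hc' : 0 < (1 - α (n + 1)) * c := mul_pos (sub_pos.2 ha.2) hc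
  have key := integral_observation hϑ hg₀ hα hY n (C := ((1 - α (n + 1)) * c)⁻¹)
    (Φ := fun ω y => ((1 - α (n + 1)) * newton ϑ g₀ α Y n ω j
      + α (n + 1) * postMass ϑ (newton ϑ g₀ α Y n ω) y j)⁻¹)
    (fun y => Measurable.stronglyMeasurable
      (((measurable_newton_apply ϑ g₀ α Y n j).const_mul _).add
        (((measurable_postMass ϑ y j).comp (measurable_newton ϑ g₀ α Y n)).const_mul _)).inv)
    fun ω y => by
      rw [Real.norm_of_nonneg (inv_nonneg.2 (hc'.le.trans (hlow ω y)))]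
      exact inv_anti₀ hc' (hlow ω y)
  refine key.trans_le ?_
  rw [← integral_const_mul]
  refine integral_mono_of_nonneg (ae_of_all _ fun ω => tsum_nonneg fun y =>
    mul_nonneg (mixture_pos hϑ (hs ω) y).le (inv_nonneg.2 (hc'.le.trans (hlow ω y))))
    ((integrable_inv_newton_apply hϑ hg₀ hα hY hj n).const_mul _) (ae_of_all _ fun ω =>
      tsum_mixture_inv_le hϑ hC (hs ω) (hc.trans_le (h ω)) ha.1.le hn)

/-- The expected reciprocal grows by a factor at most `1 + 2 * C * α ^ 2`, hence at most `exp (2 * C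
* α ^ 2)`, and the squared rates are summable. The start `N` is where the rates have dropped to at
most `1 / 2`. -/
lemma exists_integral_inv_newton_le (hϑ : ∀ j, 0 < ϑ j)
    (hg₀ : g₀ ∈ stdSimplex ℝ (Fin (m + 1))) (hα : ∀ n, 1 ≤ n → α n ∈ Set.Ioo (0 : ℝ) 1)
    (hα_sq : Summable fun n : ℕ => α (n + 1) ^ 2) (hY : IsLearningModel P ϑ g₀ α Y)
    {j : Fin (m + 1)} (hj : 0 < g₀ j) :
    ∃ (N : ℕ) (R : ℝ), ∀ k, ∫ ω, (newton ϑ g₀ α Y (N + k) ω j)⁻¹ ∂P ≤ R := by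
  obtain ⟨C, hC0, hC⟩ := exists_tsum_poisKernel_sq_div_mixture_le hϑ j
  obtain ⟨N, hN⟩ := eventually_atTop.1
    ((tendsto_rate hα hα_sq).eventually_le_const (by norm_num : (0 : ℝ) < 1 / 2))
  have hI0 : 0 ≤ ∫ ω, (newton ϑ g₀ α Y N ω j)⁻¹ ∂P := integral_nonneg fun ω =>
    inv_nonneg.2 ((newton_mem_stdSimplex hϑ hg₀ hα N ω).1 j)
  have h : ∀ k, ∫ ω, (newton ϑ g₀ α Y (N + k) ω j)⁻¹ ∂P
      ≤ Real.exp (2 * C * ∑ l ∈ Finset.range k, α (N + 1 + l) ^ 2)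
        * ∫ ω, (newton ϑ g₀ α Y N ω j)⁻¹ ∂P := by
    intro k
    induction k with
    | zero => simp
    | succ k ih =>
      refine (integral_inv_newton_succ_le hϑ hg₀ hα hY hj hC (N + k)
        (hN (N + k) (by omega))).trans ?_
      rw [Finset.sum_range_succ, mul_add, add_comm (2 * C * _), Real.exp_add,
        mul_assoc (Real.exp _), show N + 1 + k = N + k + 1 by omega]
      refine mul_le_mul ?_ ih (integral_nonneg fun ω =>
        inv_nonneg.2 ((newton_mem_stdSimplex hϑ hg₀ hα _ ω).1 j)) (Real.exp_pos _).le
      rw [add_comm]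
      exact Real.add_one_le_exp _
  refine ⟨N, Real.exp (2 * C * tailSq α N) * ∫ ω, (newton ϑ g₀ α Y N ω j)⁻¹ ∂P, fun k =>
    (h k).trans ?_⟩
  gcongr
  exact sum_range_sq_le_tailSq hα_sq N k

/-- By Fatou the lower limit of the reciprocals has finite integral, so it is finite almost surely;
a vanishing limit mass would make the reciprocals tend to infinity. -/
lemma ae_pos_newtonLimit (hϑ : ∀ j, 0 < ϑ j)
    (hg₀ : g₀ ∈ stdSimplex ℝ (Fin (m + 1))) (hα : ∀ n, 1 ≤ n → α n ∈ Set.Ioo (0 : ℝ) 1)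
    (hα_sq : Summable fun n : ℕ => α (n + 1) ^ 2) (hY : IsLearningModel P ϑ g₀ α Y)
    (hgt : IsNewtonLimit P ϑ g₀ α Y gt) {j : Fin (m + 1)} (hj : 0 < g₀ j) :
    ∀ᵐ ω ∂P, 0 < gt ω j := by
  obtain ⟨N, R, hR⟩ := exists_integral_inv_newton_le hϑ hg₀ hα hα_sq hY hj
  have hpos : ∀ n ω, 0 < newton ϑ g₀ α Y n ω j := fun n ω => by
    obtain ⟨c, hc, h⟩ := exists_pos_le_newton_apply (Y := Y) hϑ hg₀ hα hj n
    exact hc.trans_le (h ω)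
  have hm : ∀ k, Measurable fun ω => ENNReal.ofReal (newton ϑ g₀ α Y (N + k) ω j)⁻¹ := fun k =>
    ((measurable_newton_apply ϑ g₀ α Y (N + k) j).mono
      (natSigma_le hY (N + k)) le_rfl).inv.ennreal_ofReal
  have hle : ∀ k, ∫⁻ ω, ENNReal.ofReal (newton ϑ g₀ α Y (N + k) ω j)⁻¹ ∂P ≤ ENNReal.ofReal R := by
    intro k
    rw [← ofReal_integral_eq_lintegral_ofReal (integrable_inv_newton_apply hϑ hg₀ hα hY hj _)
      (ae_of_all _ fun ω => inv_nonneg.2 (hpos _ ω).le)]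
    exact ENNReal.ofReal_le_ofReal (hR k)
  have hfin : ∫⁻ ω, liminf (fun k => ENNReal.ofReal (newton ϑ g₀ α Y (N + k) ω j)⁻¹) atTop ∂P
      ≠ ⊤ := by
    refine ne_top_of_le_ne_top (b := ENNReal.ofReal R) ENNReal.ofReal_ne_top
      ((lintegral_liminf_le hm).trans ?_)
    exact (liminf_le_liminf (Eventually.of_forall hle)).trans_eq (liminf_const _)
  filter_upwards [ae_lt_top (Measurable.liminf hm) hfin, hgt.tendsto] with ω h1 h2
  refine ((hgt.pmf ω).1 j).lt_of_ne' fun h0 => h1.ne ?_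
  have hshift : Tendsto (fun k => N + k) atTop atTop := by
    simpa only [add_comm] using tendsto_add_atTop_nat N
  have h3 : Tendsto (fun k => newton ϑ g₀ α Y (N + k) ω j) atTop (𝓝[>] 0) := by
    refine tendsto_nhdsWithin_iff.2 ⟨?_, Eventually.of_forall fun k => hpos _ ω⟩
    have h4 := ((tendsto_pi_nhds.1 h2) j).comp hshift
    rwa [h0] at h4
  exact (ENNReal.tendsto_ofReal_nhds_top.2 (tendsto_inv_nhdsGT_zero.comp h3)).liminf_eq

end Model
end QuasiBayes

theorem mainTheorem7 {Ω : Type*} [MeasurableSpace Ω] (P : Measure Ω) [IsProbabilityMeasure P]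
    (m : ℕ) (ϑ g₀ : Fin (m + 1) → ℝ) (α b : ℕ → ℝ) (Y : ℕ → Ω → ℕ)
    (hϑ_pos : ∀ j, 0 < ϑ j) (hϑ_mono : StrictMono ϑ)
    (hg₀ : g₀ ∈ stdSimplex ℝ (Fin (m + 1)))
    (hα : ∀ n, 1 ≤ n → α n ∈ Set.Ioo (0 : ℝ) 1)
    (hα_sum : ¬ Summable fun n : ℕ => α (n + 1))
    (hα_sq : Summable fun n : ℕ => α (n + 1) ^ 2)
    (hY : QuasiBayes.IsLearningModel P ϑ g₀ α Y)
    (hb_pos : ∀ n, 1 ≤ n → 0 < b n)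
    (hb_mono : MonotoneOn b (Set.Ici 1))
    (hb_top : Tendsto b atTop atTop)
    (hb_four : Summable fun n : ℕ => α (n + 1) ^ 4 * b (n + 1) ^ 2)
    (hb_sup : Tendsto (fun n => b n * ⨆ k : ℕ, α (n + k) ^ 2) atTop (𝓝 0))
    (hb_tail : Tendsto (fun n => b n * ∑' k : ℕ, α (n + k) ^ 2) atTop (𝓝 1)) :
    (∃ gt : Ω → Fin (m + 1) → ℝ, QuasiBayes.IsNewtonLimit P ϑ g₀ α Y gt) ∧
    ∀ gt : Ω → Fin (m + 1) → ℝ, QuasiBayes.IsNewtonLimit P ϑ g₀ α Y gt →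
      (∀ ω, (QuasiBayes.covMatrix ϑ (gt ω)).PosSemidef) ∧
      (∃ (K : Kernel Ω (EuclideanSpace ℝ (Fin m))) (_ : IsMarkovKernel K),
        (∀ ω, K ω = multivariateGaussian 0 (QuasiBayes.covMatrix ϑ (gt ω))) ∧
        QuasiBayes.AlmostSureCondConv P (QuasiBayes.natSigma Y)
          (QuasiBayes.scaledError ϑ g₀ α b Y gt) K ∧
        QuasiBayes.AlmostSureCondConv P (QuasiBayes.natSigma Y)
          (fun n => QuasiBayes.scaledError ϑ g₀ α b Y gt (n + 1)) K) ∧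
      ((∀ j, 0 < g₀ j) → ∀ᵐ ω ∂P, (QuasiBayes.covMatrix ϑ (gt ω)).PosDef) := by
  refine ⟨QuasiBayes.exists_isNewtonLimit hϑ_pos hg₀ hα hY, fun gt hgt =>
    ⟨fun ω => QuasiBayes.posSemidef_covMatrix hϑ_pos (hgt.pmf ω), ?_, fun hpos => ?_⟩⟩
  · obtain ⟨K, hKm, hK⟩ := QuasiBayes.exists_gaussKernel hϑ_pos hgt.measurable hgt.pmf
    exact ⟨K, hKm, hK,
      QuasiBayes.almostSureCondConv_scaledError hϑ_pos hg₀ hα hα_sq hY hgt hb_pos hb_sup hb_tail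
        K hK,
      QuasiBayes.almostSureCondConv_scaledError_succ hϑ_pos hg₀ hα hα_sq hY hgt hb_pos hb_sup
        hb_tail K hK⟩
  · have h : ∀ᵐ ω ∂P, ∀ j, 0 < gt ω j := ae_all_iff.2 fun j =>
      QuasiBayes.ae_pos_newtonLimit hϑ_pos hg₀ hα hα_sq hY hgt (hpos j)
    filter_upwards [h] with ω hω
    exact QuasiBayes.posDef_covMatrix hϑ_pos hϑ_mono.injective (hgt.pmf ω) hω
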